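/- Let $\mathcal M$ be a complex four-manifold; all tensors below are holomorphic and $[\cdot,\cdot]$ is the Lie bracket of holomorphic vector fields. A (complexified) hyper-Hermitian structure on $\mathcal M$ is a quadruple $(g,I,J,K)$, where $g$ is a holomorphic metric (a nondegenerate symmetric complex bilinear form on each holomorphic tangent space) and $I,J,K$ are holomorphic endomorphism fields of $T\mathcal M$ with $I^2=J^2=K^2=-1$, $IJ=-JI=K$, such that for all real $(a,b,c)$ with $a^2+b^2+c^2=1$ the tensor $\mathcal J=aI+bJ+cK$ has vanishing Nijenhuis tensor, $\mathcal J^2[X,Y]-\mathcal J[\mathcal JX,Y]-\mathcal J[X,\mathcal JY]+[\mathcal JX,\mathcal JY]=0$, and $g(\mathcal JX,\mathcal JY)=g(X,Y)$. For four pointwise linearly independent holomorphic vector fields $\nabla_{AA'}$ ($A=0,1$, $A'=0',1'$) on an open set $U\subseteq\mathcal M$ and $\lambda\in\mathbb{CP}^1=\mathbb C\cup\{\infty\}$ put $$L_0=\nabla_{00'}-\lambda\nabla_{01'},\qquad L_1=\nabla_{10'}-\lambda\nabla_{11'},$$ where at $\lambda=\infty$ one takes $L_A=\nabla_{A1'}$.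 Say that $\nabla_{AA'}$ is a null tetrad for $(g,I,J,K)$ on $U$ if $g(\nabla_{AA'},\nabla_{BB'})=\varepsilon_{AB}\varepsilon_{A'B'}$ (with $\varepsilon$ antisymmetric, $\varepsilon_{01}=\varepsilon_{0'1'}=1$) and, for every $(a,b,c)$ in the unit sphere with stereographic coordinate $\lambda=(a+ib)/(c-1)$ (and $(0,0,1)\mapsto\infty$), $(aI+bJ+cK)L_A=iL_A$ for $A=0,1$. 1. If $\nabla_{AA'}$ are four independent holomorphic vector fields on $\mathcal M$ with $[L_0,L_1]=0$ for every $\lambda\in\mathbb{CP}^1$, then there is a hyper-Hermitian structure $(g,I,J,K)$ on $\mathcal M$ for which $\nabla_{AA'}$ is a null tetrad. 2. Every hyper-Hermitian metric arises in this way, locally and up to a conformal factor: if $(g,I,J,K)$ is a hyper-Hermitian structure on $\mathcal M$, then every point has an open neighbourhood $U$ on which there are a nowhere vanishing holomorphic function $\Omega$ and four independent holomorphic vector fields $\nabla_{AA'}$ with $[L_0,L_1]=0$ for every $\lambda\in\mathbb{CP}^1$, such that $\nabla_{AA'}$ is a null tetrad for $(\Omega g,I,J,K)$ on $U$. 3.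 For four independent holomorphic vector fields on an open set $U\subseteq\mathcal M$, the condition $[L_0,L_1]=0$ for every $\lambda\in\mathbb{CP}^1$ is equivalent to the commutator equations, for all $A,B\in\{0,1\}$, $$[\nabla_{A0'},\nabla_{B0'}]=0,\qquad [\nabla_{A0'},\nabla_{B1'}]+[\nabla_{A1'},\nabla_{B0'}]=0,\qquad [\nabla_{A1'},\nabla_{B1'}]=0.$$ -/

import Mathlib

open scoped Manifold ContDiff Bundle

noncomputable section

namespace HyperHermitian

/-- The model space of complex four-manifolds. -/
abbrev C4 : Type := EuclideanSpace ℂ (Fin 4)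

section Fields

variable (M : Type*) [TopologicalSpace M] [ChartedSpace C4 M]

/-- (Set-theoretic) sections of the holomorphic tangent bundle. -/
abbrev VField : Type _ := (x : M) → TangentSpace 𝓘(ℂ, C4) x

/-- Fields of endomorphisms of the holomorphic tangent bundle, i.e. `(1,1)` tensors. -/
abbrev EndField : Type _ :=
  (x : M) → TangentSpace 𝓘(ℂ, C4) x →L[ℂ] TangentSpace 𝓘(ℂ, C4) x

/-- Fields of complex bilinear forms on the holomorphic tangent bundle. -/
abbrev BilinField : Type _ :=
  (x : M) → TangentSpace 𝓘(ℂ, C4) x →L[ℂ] TangentSpace 𝓘(ℂ, C4) x →L[ℂ] ℂ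

/-- Four vector fields `∇_{AA'}`, the unprimed index `A` coming first. -/
abbrev TetradField : Type _ := Fin 2 → Fin 2 → VField M

end Fields

variable {M : Type*} [TopologicalSpace M] [ChartedSpace C4 M] [IsManifold 𝓘(ℂ, C4) ω M]

/-- `X` is a holomorphic vector field on `U`. -/
def HolVectorOn (X : VField M) (U : Set M) : Prop :=
  ContMDiffOn 𝓘(ℂ, C4) 𝓘(ℂ, C4).tangent ω
    (fun x ↦ (X x : TangentBundle 𝓘(ℂ, C4) M)) U

/-- `T` is a holomorphic section of `End(TM)`. -/
def HolEnd (T : EndField M) : Prop :=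
  ContMDiff 𝓘(ℂ, C4) (𝓘(ℂ, C4).prod 𝓘(ℂ, C4 →L[ℂ] C4)) ω
    (fun x ↦ Bundle.TotalSpace.mk' (C4 →L[ℂ] C4)
      (E := fun x : M ↦ TangentSpace 𝓘(ℂ, C4) x →L[ℂ] TangentSpace 𝓘(ℂ, C4) x) x (T x))

/-- `g` is a holomorphic section of `T*M ⊗ T*M`. -/
def HolBilin (g : BilinField M) : Prop :=
  ContMDiff 𝓘(ℂ, C4) (𝓘(ℂ, C4).prod 𝓘(ℂ, C4 →L[ℂ] C4 →L[ℂ] ℂ)) ω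
    (fun x ↦ Bundle.TotalSpace.mk' (C4 →L[ℂ] C4 →L[ℂ] ℂ)
      (E := fun x : M ↦ TangentSpace 𝓘(ℂ, C4) x →L[ℂ] TangentSpace 𝓘(ℂ, C4) x →L[ℂ] ℂ) x (g x))

/-- The Lie bracket of vector fields. -/
abbrev bracket (X Y : VField M) : VField M := VectorField.mlieBracket 𝓘(ℂ, C4) X Y

/-- The vector field `T X`. -/
def EndField.act (T : EndField M) (X : VField M) : VField M := fun x ↦ T x (X x)

/-- The Nijenhuis expression `T²[X,Y] - T[TX,Y] - T[X,TY] + [TX,TY]`. -/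
def nijenhuis (T : EndField M) (X Y : VField M) : VField M := fun x ↦
  T x (T x (bracket X Y x)) - T x (bracket (T.act X) Y x) - T x (bracket X (T.act Y) x)
    + bracket (T.act X) (T.act Y) x

/-- Integrability: the Nijenhuis tensor vanishes. Local fields are used, since `M` may carry
few global holomorphic ones. -/
def Integrable (T : EndField M) : Prop :=
  ∀ (U : Set M), IsOpen U → ∀ X Y : VField M, HolVectorOn X U → HolVectorOn Y U →
    ∀ x ∈ U, nijenhuis T X Y x = 0

/-- The combination `a I + b J + c K` with real coefficients. -/
def combo (I J K : EndField M) (a b c : ℝ) : EndField M := fun x ↦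
  (a : ℂ) • I x + (b : ℂ) • J x + (c : ℂ) • K x

/-- A (complexified) hypercomplex structure: holomorphic endomorphisms `I, J, K` of the tangent
bundle with the quaternion relations, such that `a I + b J + c K` is integrable for every
`(a, b, c)` in the unit sphere. -/
structure IsHypercomplex (I J K : EndField M) : Prop where
  hol_I : HolEnd I
  hol_J : HolEnd J
  hol_K : HolEnd K
  I_sq : ∀ x v, I x (I x v) = -v
  J_sq : ∀ x v, J x (J x v) = -v
  K_sq : ∀ x v, K x (K x v) = -v
  I_J : ∀ x v, I x (J x v) = K x v
  J_I : ∀ x v, J x (I x v) = -K x v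
  integrable : ∀ a b c : ℝ, a ^ 2 + b ^ 2 + c ^ 2 = 1 → Integrable (combo I J K a b c)

/-- A holomorphic metric: a holomorphic field of nondegenerate symmetric bilinear forms. -/
structure IsHolMetric (g : BilinField M) : Prop where
  hol : HolBilin g
  symm : ∀ x v w, g x v w = g x w v
  nondegenerate : ∀ x v, (∀ w, g x v w = 0) → v = 0

/-- A (complexified) hyper-Hermitian structure `(g, I, J, K)`. -/
structure IsHyperHermitian (g : BilinField M) (I J K : EndField M) : Prop where
  metric : IsHolMetric g
  hypercomplex : IsHypercomplex I J K
  hermitian : ∀ a b c : ℝ, a ^ 2 + b ^ 2 + c ^ 2 = 1 → ∀ x v w,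
    g x (combo I J K a b c x v) (combo I J K a b c x w) = g x v w

/-- The symplectic form on two-component spinors, `ε₀₁ = 1`. -/
def eps : Matrix (Fin 2) (Fin 2) ℂ := !![0, 1; -1, 0]

/-- Four holomorphic vector fields on `U` that are linearly independent at each point of `U`. -/
structure IsHolFrameOn (V : TetradField M) (U : Set M) : Prop where
  hol : ∀ A A', HolVectorOn (V A A') U
  indep : ∀ x ∈ U, LinearIndependent ℂ (fun p : Fin 2 × Fin 2 ↦ V p.1 p.2 x)

/-- The vector field `L_A = ∇_{A0'} - l ∇_{A1'}` for `l` in the Riemann sphere. At `l = ∞` this is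
`∇_{A1'}`, the representative in homogeneous coordinates. -/
def lax (V : TetradField M) (A : Fin 2) (l : OnePoint ℂ) : VField M :=
  OnePoint.elim (Y := VField M) l (V A 1) (fun z : ℂ ↦ fun x ↦ V A 0 x - z • V A 1 x)

/-- The Lax condition `[L_0, L_1] = 0` on `U`, for every value of the spectral parameter. -/
def LaxOn (V : TetradField M) (U : Set M) : Prop :=
  ∀ l : OnePoint ℂ, ∀ x ∈ U, bracket (lax V 0 l) (lax V 1 l) x = 0

/-- The commutator equations of the tetrad on `U`. -/
def CommutatorEqsOn (V : TetradField M) (U : Set M) : Prop :=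
  ∀ A B : Fin 2, ∀ x ∈ U,
    bracket (V A 0) (V B 0) x = 0 ∧
    bracket (V A 0) (V B 1) x + bracket (V A 1) (V B 0) x = 0 ∧
    bracket (V A 1) (V B 1) x = 0

/-- The stereographic coordinate `(a + i b) / (c - 1)` on the unit sphere, with `(0,0,1) ↦ ∞`. -/
def stereo (a b c : ℝ) : OnePoint ℂ :=
  open Classical in
  if c = 1 then OnePoint.infty else (((a + Complex.I * b) / (c - 1) : ℂ) : OnePoint ℂ)

/-- `V` is, on `U`, a null tetrad for the metric `g` with the complex structures `I, J, K`:
`g(∇_{AA'}, ∇_{BB'}) = ε_{AB} ε_{A'B'}`, and the tetrad carries the orientation and the spectral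
parameter determined by the complex structures: `L_0, L_1` at the parameter of `(a, b, c)` are
eigenvectors of `a I + b J + c K` with eigenvalue `i`. -/
structure IsNullTetradOn (g : BilinField M) (I J K : EndField M) (V : TetradField M)
    (U : Set M) : Prop where
  null : ∀ x ∈ U, ∀ A A' B B', g x (V A A' x) (V B B' x) = eps A B * eps A' B'
  adapted : ∀ a b c : ℝ, a ^ 2 + b ^ 2 + c ^ 2 = 1 → ∀ x ∈ U, ∀ A,
    combo I J K a b c x (lax V A (stereo a b c) x) = Complex.I • lax V A (stereo a b c) x

end HyperHermitian

end

/-! The bracket `[L_0, L_1]` is a quadratic polynomial in the spectral parameter, and its three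
coefficients are the commutator equations with `A ≠ B`; the cases `A = B` hold by antisymmetry. This
is the third claim (`laxOn_iff_commutatorEqsOn`).

For the first claim, `I, J, K` act on the primed index of the tetrad by constant matrices, and the
metric is the product of the two area forms. Unit combinations of `I, J, K` are given by traceless
matrices of determinant one, so they preserve the primed area form and hence the metric. The
Nijenhuis expression is tensorial and need only be checked on the tetrad. There the commutator
equations make every bracket of constant combinations of the `∇_{AA'}` and the `∇_{BB'}` a multiple
of `[∇_{A0'}, ∇_{B1'}]` by a 2 by 2 determinant; trace zero and determinant one then make the
expression vanish (`integrable_frameEnd`).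

For the second claim, work in a chart. Integrability makes the eigendistributions of `I` and `K`
involutive. The Frobenius theorem gives a map `w` whose differential has the eigenspace `K = -i` as
its kernel. Take a frame `X_A` of the eigenspace `K = i` on which `dw` is constant, and set `Y_A =
-i I X_A`, a frame of the other eigenspace. Then `[X_0, X_1]` lies in `K = i` and is killed by `dw`,
so it is zero. Both `[Y_0, Y_1]` and `[Y_0, X_1] + [X_0, Y_1]` lie in `K = -i`. Since `Y_A ± X_A`
are eigenvectors of `I`, the combinations `[Y_0, Y_1] ± ([Y_0, X_1] + [X_0, Y_1])` are also
eigenvectors of `I`; as `I` and `K` anticommute, they vanish (`exists_local_tetrad`). Invariance of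
the metric under `I` and `K` fixes it on this tetrad up to a scalar function
(`IsHyperHermitian.metric_tetrad`), whose inverse is the conformal factor.

The holomorphic Frobenius theorem (`exists_first_integral`) is proved by solving the flow equation
with the analytic implicit function theorem in a space of continuous paths, which gives analytic
dependence on the data at once. -/

noncomputable section

namespace HyperHermitian

open Topology

/-! ### Analytic superposition operators on spaces of continuous functions -/

section Nemytskii

variable {K E F : Type*} [TopologicalSpace K] [CompactSpace K]
  [NormedAddCommGroup E] [NormedSpace ℂ E] [NormedAddCommGroup F] [NormedSpace ℂ F]

/-- The action of a continuous multilinear map on continuous functions, by composition. -/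
def multilinearComp {n : ℕ} (p : ContinuousMultilinearMap ℂ (fun _ : Fin n ↦ E) F) :
    ContinuousMultilinearMap ℂ (fun _ : Fin n ↦ C(K, E)) C(K, F) :=
  MultilinearMap.mkContinuous
    { toFun := fun c ↦ ⟨fun t ↦ p fun i ↦ c i t, by fun_prop⟩
      map_update_add' := by
        intro _ c i x y
        ext t
        have h (z : C(K, E)) : (fun j ↦ Function.update c i z j t) =
            Function.update (fun j ↦ c j t) i (z t) := by
          ext j
          by_cases hj : j = i
          · subst hj; simp
          · simp [hj]
        have := p.map_update_add (fun j ↦ c j t) i (x t) (y t)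
        simp [h, this]
      map_update_smul' := by
        intro _ c i a x
        ext t
        have h (z : C(K, E)) : (fun j ↦ Function.update c i z j t) =
            Function.update (fun j ↦ c j t) i (z t) := by
          ext j
          by_cases hj : j = i
          · subst hj; simp
          · simp [hj]
        have := p.map_update_smul (fun j ↦ c j t) i a (x t)
        simp [h, this] }
    ‖p‖ fun c ↦ by
      rw [ContinuousMap.norm_le _ (by positivity)]
      intro t
      refine (p.le_opNorm _).trans ?_
      gcongr with i
      exact (c i).norm_coe_le_norm t

theorem multilinearComp_apply {n : ℕ} (p : ContinuousMultilinearMap ℂ (fun _ : Fin n ↦ E) F)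
    (c : Fin n → C(K, E)) (t : K) : multilinearComp p c t = p fun i ↦ c i t := rfl

theorem norm_multilinearComp_le {n : ℕ}
    (p : ContinuousMultilinearMap ℂ (fun _ : Fin n ↦ E) F) :
    ‖multilinearComp (K := K) p‖ ≤ ‖p‖ :=
  MultilinearMap.mkContinuous_norm_le _ (norm_nonneg _) _

/-- Composition with an analytic function is analytic on spaces of continuous functions. -/
theorem exists_analyticAt_comp_continuousMap [CompleteSpace F] {f : E → F}
    (hf : AnalyticAt ℂ f 0) :
    ∃ N : C(K, E) → C(K, F), AnalyticAt ℂ N 0 ∧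
      ∀ᶠ c in 𝓝 (0 : C(K, E)), ∀ t, N c t = f (c t) := by
  obtain ⟨p, r, hp⟩ := hf
  let q : FormalMultilinearSeries ℂ C(K, E) C(K, F) := fun n ↦ multilinearComp (p n)
  have hr : p.radius ≤ q.radius :=
    FormalMultilinearSeries.radius_le_of_le fun n ↦ norm_multilinearComp_le (p n)
  have hq : 0 < q.radius := (hp.r_pos.trans_le hp.r_le).trans_le hr
  refine ⟨q.sum, (q.hasFPowerSeriesOnBall hq).analyticAt, ?_⟩
  filter_upwards [Metric.eball_mem_nhds (0 : C(K, E)) hp.r_pos] with c hc t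
  have hc' : c ∈ Metric.eball (0 : C(K, E)) q.radius :=
    Metric.eball_subset_eball (hp.r_le.trans hr) hc
  have h1 := (q.hasFPowerSeriesOnBall hq).hasSum hc'
  -- Evaluation at `t` is continuous and linear, so it commutes with the sum and turns the series on
  -- path space into the series of `f` at `c t`.
  have h2 : HasSum (fun n ↦ p n fun _ ↦ c t) (q.sum c t) := by
    have := h1.mapL (ContinuousMap.evalCLM ℂ t)
    simpa [q, multilinearComp_apply] using this
  have hct : c t ∈ Metric.eball (0 : E) r := by
    rw [Metric.mem_eball, edist_zero_right] at hc ⊢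
    refine lt_of_le_of_lt ?_ hc
    exact enorm_le_iff_norm_le.2 (c.norm_coe_le_norm t)
  have h3 := hp.hasSum hct
  rw [zero_add] at h3
  exact h2.unique h3

end Nemytskii

/-! ### The integration operator on paths -/

section Volterra

variable {E : Type*} [NormedAddCommGroup E]

local notation "𝕀" => Set.Icc (0 : ℝ) 1

/-- The constant extension of a path on the unit interval. -/
def extendPath (c : C(𝕀, E)) : ℝ → E := Set.IccExtend zero_le_one c

theorem extendPath_continuous (c : C(𝕀, E)) : Continuous (extendPath c) :=
  c.continuous.Icc_extend'

theorem extendPath_apply (c : C(𝕀, E)) {t : ℝ} (ht : t ∈ 𝕀) : extendPath c t = c ⟨t, ht⟩ :=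
  Set.IccExtend_of_mem _ _ ht

theorem norm_extendPath_le (c : C(𝕀, E)) (t : ℝ) : ‖extendPath c t‖ ≤ ‖c‖ :=
  c.norm_coe_le_norm _

variable [NormedSpace ℂ E] [CompleteSpace E]

/-- The integration operator on continuous paths. -/
def volterra : C(𝕀, E) →L[ℂ] C(𝕀, E) :=
  LinearMap.mkContinuous
    { toFun := fun c ↦ ⟨fun t ↦ ∫ s in (0 : ℝ)..t, extendPath c s,
        (intervalIntegral.continuous_primitive
          (fun _ _ ↦ (extendPath_continuous c).intervalIntegrable _ _) 0).comp
            continuous_subtype_val⟩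
      map_add' := fun c d ↦ by
        ext t
        exact intervalIntegral.integral_add ((extendPath_continuous c).intervalIntegrable _ _)
          ((extendPath_continuous d).intervalIntegrable _ _)
      map_smul' := fun a c ↦ by
        ext t
        exact intervalIntegral.integral_smul a _ }
    1 fun c ↦ by
      rw [ContinuousMap.norm_le _ (by positivity)]
      intro t
      refine (intervalIntegral.norm_integral_le_of_norm_le_const
        (fun s _ ↦ norm_extendPath_le c s)).trans ?_
      rw [sub_zero, abs_of_nonneg t.2.1, one_mul]
      exact mul_le_of_le_one_right (norm_nonneg _) t.2.2

omit [CompleteSpace E] in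
theorem volterra_apply (c : C(𝕀, E)) (t : 𝕀) :
    volterra c t = ∫ s in (0 : ℝ)..t, extendPath c s := rfl

end Volterra

open Topology

/-! ### Analytic flows by the implicit function theorem -/

section Flow

variable {E : Type*} [NormedAddCommGroup E] [NormedSpace ℂ E]

local notation "𝕀" => Set.Icc (0 : ℝ) 1

/-- Pointwise application, through a bilinear map, of a path to a vector. -/
def pathBilin {A F : Type*} [NormedAddCommGroup A] [NormedSpace ℂ A] [NormedAddCommGroup F]
    [NormedSpace ℂ F] (B : A →L[ℂ] E →L[ℂ] F) : C(𝕀, A) →L[ℂ] E →L[ℂ] C(𝕀, F) :=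
  LinearMap.mkContinuous₂
    (LinearMap.mk₂ ℂ (fun (T : C(𝕀, A)) (v : E) ↦ (⟨fun t ↦ B (T t) v, by fun_prop⟩ : C(𝕀, F)))
      (fun S T v ↦ by ext t; exact B.map_add₂ (S t) (T t) v)
      (fun a T v ↦ by ext t; exact B.map_smul₂ a (T t) v)
      (fun T v w ↦ by ext t; exact (B (T t)).map_add v w)
      (fun a T v ↦ by ext t; exact (B (T t)).map_smul a v))
    ‖B‖ fun T v ↦ by
      rw [LinearMap.mk₂_apply, ContinuousMap.norm_le _ (by positivity)]
      intro t
      refine (B.le_opNorm₂ (T t) v).trans ?_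
      gcongr
      exact T.norm_coe_le_norm t

theorem pathBilin_apply {A F : Type*} [NormedAddCommGroup A] [NormedSpace ℂ A]
    [NormedAddCommGroup F] [NormedSpace ℂ F] (B : A →L[ℂ] E →L[ℂ] F) (T : C(𝕀, A)) (v : E)
    (t : 𝕀) : pathBilin B T v t = B (T t) v := rfl

/-- The path `t ↦ t • Q v + (v - Q v)`, which joins `v - Q v` to `v`. -/
def linePath (Q : E →L[ℂ] E) : E →L[ℂ] C(𝕀, E) :=
  LinearMap.mkContinuous
    { toFun := fun v ↦ ⟨fun t ↦ ((t : ℝ) : ℂ) • Q v + (v - Q v), by fun_prop⟩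
      map_add' := fun v w ↦ by
        ext t
        simp only [map_add, ContinuousMap.coe_mk, ContinuousMap.add_apply]
        module
      map_smul' := fun a v ↦ by
        ext t
        simp only [map_smul, ContinuousMap.coe_mk, ContinuousMap.smul_apply, RingHom.id_apply]
        module }
    (‖Q‖ + (1 + ‖Q‖)) fun v ↦ by
      rw [ContinuousMap.norm_le _ (by positivity)]
      intro t
      have ht : ‖((t : ℝ) : ℂ)‖ ≤ 1 := by
        rw [Complex.norm_real, Real.norm_of_nonneg t.2.1]; exact t.2.2
      have hQ := Q.le_opNorm v
      calc _ ≤ ‖((t : ℝ) : ℂ)‖ * ‖Q v‖ + (‖v‖ + ‖Q v‖) := by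
            refine (norm_add_le _ _).trans ?_
            rw [norm_smul]
            gcongr
            exact norm_sub_le _ _
        _ ≤ 1 * (‖Q‖ * ‖v‖) + (‖v‖ + ‖Q‖ * ‖v‖) := by gcongr
        _ = _ := by ring

theorem linePath_apply (Q : E →L[ℂ] E) (v : E) (t : 𝕀) :
    linePath Q v t = ((t : ℝ) : ℂ) • Q v + (v - Q v) := rfl

variable [CompleteSpace E] {A : Type*} [NormedAddCommGroup A] [NormedSpace ℂ A] [CompleteSpace A]

theorem _root_.ContinuousLinearMap.contDiffAt_bilinear {X A' F' G' : Type*}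
    [NormedAddCommGroup X] [NormedSpace ℂ X] [NormedAddCommGroup A'] [NormedSpace ℂ A']
    [NormedAddCommGroup F'] [NormedSpace ℂ F'] [NormedAddCommGroup G'] [NormedSpace ℂ G']
    (β : A' →L[ℂ] F' →L[ℂ] G') {f : X → A'} {g : X → F'} {x : X} {n : WithTop ℕ∞}
    (hf : ContDiffAt ℂ n f x) (hg : ContDiffAt ℂ n g x) :
    ContDiffAt ℂ n (fun y ↦ β (f y) (g y)) x := by
  fun_prop

theorem _root_.ContinuousLinearMap.hasFDerivAt_bilinear_zero {X A' F' G' : Type*}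
    [NormedAddCommGroup X] [NormedSpace ℂ X] [NormedAddCommGroup A'] [NormedSpace ℂ A']
    [NormedAddCommGroup F'] [NormedSpace ℂ F'] [NormedAddCommGroup G'] [NormedSpace ℂ G']
    (β : A' →L[ℂ] F' →L[ℂ] G') {f : X → A'} {g : X → F'} {x : X}
    (hf : DifferentiableAt ℂ f x) (hg : DifferentiableAt ℂ g x) (hf0 : f x = 0) (hg0 : g x = 0) :
    HasFDerivAt (fun y ↦ β (f y) (g y)) (0 : X →L[ℂ] G') x := by
  convert β.hasFDerivAt_of_bilinear hf.hasFDerivAt hg.hasFDerivAt using 1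
  ext y
  change (0 : G') = β (f x) (fderiv ℂ g x y) + β (fderiv ℂ f x y) (g x)
  rw [hf0, hg0, map_zero, map_zero, _root_.zero_apply, add_zero]

/-- Analytic dependence on `v` of the solution of `c' = Q v + B(G(c), v)`, `c(0) = v - Q v` on the
unit interval, written as `c = b v + linePath Q v`. -/
theorem exists_analytic_flow (B : A →L[ℂ] E →L[ℂ] E) {G : E → A} (Q : E →L[ℂ] E) (hG : AnalyticAt ℂ G 0)
    (hG0 : G 0 = 0) :
    ∃ b : E → C(𝕀, E), ContDiffAt ℂ ω b 0 ∧ b 0 = 0 ∧ HasFDerivAt b (0 : E →L[ℂ] C(𝕀, E)) 0 ∧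
      (∀ᶠ v in 𝓝 0, ∃ D : C(𝕀, E), (∀ t, D t = B (G (b v t + linePath Q v t)) v) ∧
        b v = volterra D) ∧
      ∀ᶠ p : E × C(𝕀, E) in 𝓝 0, (∃ D : C(𝕀, E),
        (∀ t, D t = B (G (p.2 t + linePath Q p.1 t)) p.1) ∧ p.2 = volterra D) → b p.1 = p.2 := by
  obtain ⟨N, hN, hNG⟩ := exists_analyticAt_comp_continuousMap (K := 𝕀) hG
  have hN0 : N 0 = 0 := by
    ext t : 1
    simpa [hG0] using hNG.self_of_nhds t
  let inner : E × C(𝕀, E) → C(𝕀, E) := fun p ↦ p.2 + linePath Q p.1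
  -- The zeros of `Ψ` are the solutions of the integral equation, with the deviation from `linePath`
  -- as unknown. The nonlinear term is bilinear in two factors that both vanish at the origin, so
  -- the derivative of `Ψ` there is the projection to the path variable and the implicit function
  -- theorem applies.
  let Ψ : E × C(𝕀, E) → C(𝕀, E) := fun p ↦ p.2 - volterra (pathBilin B (N (inner p)) p.1)
  have hinner : ContDiff ℂ ω inner := by fun_prop
  have hinner0 : inner 0 = 0 := by simp [inner]
  have hNi : ContDiffAt ℂ ω (fun p ↦ N (inner p)) 0 :=
    ContDiffAt.comp (0 : E × C(𝕀, E)) (g := N) (by rw [hinner0]; exact hN.contDiffAt)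
      hinner.contDiffAt
  have hΨ : ContDiffAt ℂ ω Ψ 0 := by
    exact contDiffAt_snd.sub ((ContinuousLinearMap.contDiff (E := C(𝕀, E)) (F := C(𝕀, E))
      volterra).contDiffAt.comp _ ((pathBilin B).contDiffAt_bilinear hNi contDiffAt_fst))
  have hΨ' : HasFDerivAt Ψ (ContinuousLinearMap.snd ℂ E C(𝕀, E)) 0 := by
    have h1 : HasFDerivAt (fun p : E × C(𝕀, E) ↦ pathBilin B (N (inner p)) p.1) 0 0 :=
      (pathBilin B).hasFDerivAt_bilinear_zero (hNi.differentiableAt (by simp))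
        differentiableAt_fst (by rw [hinner0, hN0]) rfl
    have := hasFDerivAt_snd.sub (volterra.hasFDerivAt.comp (0 : E × C(𝕀, E)) h1)
    rw [ContinuousLinearMap.comp_zero, sub_zero] at this
    exact this
  have hinr : fderiv ℂ Ψ (0, 0) ∘L .inr ℂ E C(𝕀, E) = ContinuousLinearMap.id ℂ _ := by
    rw [show ((0, 0) : E × C(𝕀, E)) = 0 from rfl, hΨ'.fderiv]; ext; simp
  have hinv : (fderiv ℂ Ψ (0, 0) ∘L .inr ℂ E C(𝕀, E)).IsInvertible := by
    rw [hinr]; exact ContinuousLinearMap.isInvertible_equiv (f := .refl ℂ _)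
  have hΨ2 : ContDiffAt ℂ ω Ψ (0, 0) := hΨ
  have hone : (ω : WithTop ℕ∞) ≠ 0 := by simp
  have hΨ0 : Ψ (0, 0) = 0 := by simp [Ψ]
  refine ⟨hΨ2.implicitFunction hone hinv, hΨ2.contDiffAt_implicitFunction hone hinv,
    hΨ2.implicitFunction_apply_self hone hinv, ?_, ?_, ?_⟩
  · have := (hΨ2.hasStrictFDerivAt_implicitFunction hone hinv).hasFDerivAt
    -- `Ψ` has no first-order dependence on the parameter, so neither has the solution. This later
    -- makes the straightening tangent to the identity.
    have h0 : fderiv ℂ Ψ (0, 0) ∘L .inl ℂ E C(𝕀, E) = 0 := by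
      rw [show ((0, 0) : E × C(𝕀, E)) = 0 from rfl, hΨ'.fderiv]; ext; simp
    rw [h0, ContinuousLinearMap.comp_zero, neg_zero] at this
    exact this
  · have hcont : Filter.Tendsto (fun v ↦ inner (v, hΨ2.implicitFunction hone hinv v)) (𝓝 0)
        (𝓝 0) := by
      have h1 : ContinuousAt (fun v ↦ inner (v, hΨ2.implicitFunction hone hinv v)) 0 :=
        hinner.continuous.continuousAt.comp
          (continuousAt_id.prodMk (hΨ2.contDiffAt_implicitFunction hone hinv).continuousAt)
      have h2 : inner (0, hΨ2.implicitFunction hone hinv 0) = 0 := by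
        have := hΨ2.implicitFunction_apply_self hone hinv
        simp only at this
        rw [this]; exact hinner0
      simpa only [ContinuousAt, h2] using h1
    filter_upwards [hΨ2.eventually_apply_implicitFunction hone hinv, hcont.eventually hNG]
      with v hv hN
    refine ⟨pathBilin B (N (inner (v, hΨ2.implicitFunction hone hinv v))) v, fun t ↦ ?_, ?_⟩
    · rw [pathBilin_apply, hN]; rfl
    · rw [hΨ0] at hv
      exact sub_eq_zero.1 hv
  · have hcont : Filter.Tendsto inner (𝓝 0) (𝓝 0) := by
      simpa only [ContinuousAt, hinner0] using hinner.continuous.continuousAt (x := 0)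
    filter_upwards [hΨ2.eventually_apply_eq_iff_implicitFunction hone hinv,
      hcont.eventually hNG] with p hp hN
    rintro ⟨D, hD, hpD⟩
    refine hp.1 ?_
    rw [hΨ0]
    refine sub_eq_zero.2 (hpD.trans ?_)
    congr 1
    ext t
    rw [hD, pathBilin_apply, hN]; rfl

end Flow

open Topology

/-! ### The time-one map and its radial equation -/

section Straightening

variable {E : Type*} [NormedAddCommGroup E]

local notation "𝕀" => Set.Icc (0 : ℝ) 1

/-- Closeness in the supremum norm puts the whole path into a given neighbourhood, so local
conditions hold along it uniformly in time. -/
theorem eventually_forall_path {p : E → Prop} (hp : ∀ᶠ u in 𝓝 0, p u) {f : E → C(𝕀, E)}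
    (hf : ContinuousAt f 0) (hf0 : f 0 = 0) : ∀ᶠ v in 𝓝 0, ∀ t, p (f v t) := by
  obtain ⟨ε, hε, h⟩ := Metric.eventually_nhds_iff.1 hp
  have h2 : ∀ᶠ c in 𝓝 (f 0), ‖c‖ < ε := by
    rw [hf0]
    filter_upwards [Metric.ball_mem_nhds (0 : C(𝕀, E)) hε] with c hc
    simpa using hc
  filter_upwards [hf.eventually h2] with v hv t
  refine h ?_
  rw [dist_zero_right]
  exact ((f v).norm_coe_le_norm t).trans_lt hv

variable [NormedSpace ℂ E]

theorem linePath_one (Q : E →L[ℂ] E) (v : E) : linePath Q v 1 = v := by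
  simp [linePath_apply]

theorem map_linePath {Q : E →L[ℂ] E} (hQ : ∀ v, Q (Q v) = Q v) (v : E) (t : 𝕀) :
    Q (linePath Q v t) = ((t : ℝ) : ℂ) • Q v := by
  simp [linePath_apply, hQ]

/-- `Q` being a projection, `linePath Q · t` scales the range of `Q` by `t` and fixes its kernel;
such scalings compose multiplicatively. -/
theorem linePath_linePath {Q : E →L[ℂ] E} (hQ : ∀ v, Q (Q v) = Q v) (v : E) (t τ : 𝕀) :
    linePath Q (linePath Q v t) τ = linePath Q v (t * τ) := by
  rw [linePath_apply, map_linePath hQ, linePath_apply, linePath_apply, Set.Icc.coe_mul]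
  push_cast
  module

theorem volterra_scale (D : C(𝕀, E)) (t : 𝕀) {D' : C(𝕀, E)}
    (hD' : ∀ τ, D' τ = ((t : ℝ) : ℂ) • D (t * τ)) (τ : 𝕀) :
    volterra D' τ = volterra D (t * τ) := by
  rw [volterra_apply, volterra_apply, Set.Icc.coe_mul]
  have h := intervalIntegral.smul_integral_comp_mul_left (a := 0) (b := (τ : ℝ)) (extendPath D) t
  rw [mul_zero] at h
  rw [← h, ← intervalIntegral.integral_smul]
  refine intervalIntegral.integral_congr fun s hs ↦ ?_
  rw [Set.uIcc_of_le τ.2.1] at hs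
  have hs' : s ∈ 𝕀 := ⟨hs.1, hs.2.trans τ.2.2⟩
  have hts : (t : ℝ) * s ∈ 𝕀 := unitInterval.mul_mem t.2 hs'
  rw [extendPath_apply _ hs', extendPath_apply _ hts, hD']
  simp only [Complex.coe_smul]
  rfl

/-- Solution paths of a radial equation, rescaled, are solution paths. -/
theorem flow_rescale {X : E → E →L[ℂ] E} {Q : E →L[ℂ] E} (hQ : ∀ v, Q (Q v) = Q v)
    (hXQ : ∀ᶠ u in 𝓝 0, ∀ f, X u (Q f) = X u f) {b : E → C(𝕀, E)} (hb : ContinuousAt b 0)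
    (hb0 : b 0 = 0)
    (hA : ∀ᶠ v in 𝓝 0, ∃ D : C(𝕀, E), (∀ t, D t = (X (b v t + linePath Q v t) - Q) v) ∧
        b v = volterra D)
    (hU : ∀ᶠ p : E × C(𝕀, E) in 𝓝 0, (∃ D : C(𝕀, E),
        (∀ t, D t = (X (p.2 t + linePath Q p.1 t) - Q) p.1) ∧ p.2 = volterra D) → b p.1 = p.2) :
    ∀ᶠ v in 𝓝 0, ∀ t, b (linePath Q v t) 1 = b v t := by
  obtain ⟨ε, hε, hU⟩ := Metric.eventually_nhds_iff.1 hU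
  have hline : ContinuousAt (linePath Q) 0 := (linePath Q).continuous.continuousAt
  have hsmall : ∀ᶠ v in 𝓝 (0 : E), ‖v‖ < ε := by
    filter_upwards [Metric.ball_mem_nhds (0 : E) hε] with c hc
    simpa using hc
  have hbs : ∀ᶠ v in 𝓝 (0 : E), ‖b v‖ < ε := by
    have := hb.norm
    rw [ContinuousAt, hb0, norm_zero] at this
    exact this.eventually_lt_const hε
  filter_upwards [hA, hbs, eventually_forall_path hsmall hline (map_zero _),
    eventually_forall_path (f := fun v ↦ b v + linePath Q v) hXQ (hb.add hline) (by simp [hb0])]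
    with v ⟨D, hD, hbD⟩ hbv hlv hXv t
  let scale : C(𝕀, 𝕀) := ⟨fun τ ↦ t * τ, by fun_prop⟩
  -- The slowed-down path `τ ↦ b v (t * τ)` solves the equation with parameter `linePath Q v t`;
  -- local uniqueness identifies it with the solution there, and `τ = 1` gives the claim.
  have key := @hU (linePath Q v t, (b v).comp scale) ?_ ?_
  · simp only at key
    rw [key]
    change b v (t * 1) = b v t
    rw [mul_one]
  · rw [dist_zero_right, Prod.norm_def, max_lt_iff]
    refine ⟨hlv t, lt_of_le_of_lt ?_ hbv⟩
    rw [ContinuousMap.norm_le _ (norm_nonneg _)]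
    exact fun τ ↦ (b v).norm_coe_le_norm _
  · refine ⟨((t : ℝ) : ℂ) • D.comp scale, fun τ ↦ ?_, ?_⟩
    · change ((t : ℝ) : ℂ) • D (t * τ) = _
      rw [hD, ← linePath_linePath hQ]
      have hX := hXv (t * τ)
      simp only [ContinuousMap.add_apply, ← linePath_linePath hQ] at hX
      change _ = (X (b v (t * τ) + linePath Q (linePath Q v t) τ) - Q) (linePath Q v t)
      -- `X` sees a vector only through its `Q`-component, which for `linePath Q v t` is `t • Q v`.
      -- This produces the factor `t` of the time change.
      rw [_root_.sub_apply, _root_.sub_apply, map_linePath hQ,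
        ← hX (linePath Q v t), map_linePath hQ, map_smul, hX, smul_sub]
    · ext τ
      rw [volterra_scale D t (fun _ ↦ rfl), ← hbD]
      rfl

variable [CompleteSpace E]

/-- The radial equation satisfied by the time-one map. -/
theorem fderiv_time_one {X : E → E →L[ℂ] E} {Q : E →L[ℂ] E}
    {b : E → C(𝕀, E)} {v : E} {H : E → E} (hH : ∀ v, H v = v + b v 1)
    (hd : DifferentiableAt ℂ H v)
    (hA : ∃ D : C(𝕀, E), (∀ t, D t = (X (b v t + linePath Q v t) - Q) v) ∧ b v = volterra D)
    (hR : ∀ t, b (linePath Q v t) 1 = b v t) :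
    fderiv ℂ H v (Q v) = X (H v) v := by
  obtain ⟨D, hD, hbD⟩ := hA
  have hone : (1 : ℝ) ∈ 𝕀 := ⟨zero_le_one, le_rfl⟩
  let line : ℝ → E := fun t ↦ (t : ℂ) • Q v + (v - Q v)
  have hline : HasDerivAt line (Q v) 1 := by
    have h1 : HasDerivAt (fun t : ℝ ↦ (t : ℂ)) 1 1 := Complex.ofRealCLM.hasDerivAt
    have h2 := (h1.smul_const (Q v)).add_const (v - Q v)
    rw [one_smul] at h2
    exact h2
  have hline1 : line 1 = v := by simp [line]
  have h1 : HasDerivAt (fun t : ℝ ↦ H (line t)) (fderiv ℂ H v (Q v)) 1 := by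
    have : HasFDerivAt H ((fderiv ℂ H v).restrictScalars ℝ) (line 1) := by
      rw [hline1]; exact hd.hasFDerivAt.restrictScalars ℝ
    exact this.comp_hasDerivAt 1 hline
  have h2 : HasDerivAt (fun t : ℝ ↦ line t + ∫ s in (0 : ℝ)..t, extendPath D s)
      (Q v + extendPath D 1) 1 :=
    hline.add ((extendPath_continuous D).integral_hasStrictDerivAt 0 1).hasDerivAt
  -- By the rescaling property, `H` along the segment from `v - Q v` to `v` traces the solution path
  -- itself, so its velocity at the endpoint is given by the differential equation.
  have h3 : Set.EqOn (fun t : ℝ ↦ H (line t))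
      (fun t : ℝ ↦ line t + ∫ s in (0 : ℝ)..t, extendPath D s) 𝕀 := by
    intro t ht
    have := hR ⟨t, ht⟩
    simp only
    rw [hH]
    change linePath Q v ⟨t, ht⟩ + b (linePath Q v ⟨t, ht⟩) 1 = _
    rw [this, hbD, volterra_apply]
    rfl
  have h4 := (uniqueDiffOn_Icc_zero_one 1 hone).eq_deriv _
    (h1.hasDerivWithinAt (s := 𝕀)) (h2.hasDerivWithinAt.congr h3 (h3 hone))
  rw [h4, extendPath_apply D hone]
  change Q v + D 1 = _
  rw [hD, linePath_one, hH, add_comm v, _root_.sub_apply, add_sub_cancel]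

end Straightening

open Topology

/-! ### Straightening of commuting fields -/

section FirstIntegral

variable {E : Type*} [NormedAddCommGroup E] [NormedSpace ℂ E]

local notation "𝕀" => Set.Icc (0 : ℝ) 1

/-- The defect `DH ∘ Q - X(H)` satisfies a linear equation in the radial direction, if the fields
`u ↦ X u f` commute. -/
theorem fderiv_defect {X : E → E →L[ℂ] E} {Q : E →L[ℂ] E} (hQ : ∀ v, Q (Q v) = Q v)
    {H : E → E} {v : E} (hH : ContDiffAt ℂ ω H v) (hX : DifferentiableAt ℂ X (H v))
    (hXQ : ∀ f, X (H v) (Q f) = X (H v) f)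
    (hcomm : ∀ f f', fderiv ℂ X (H v) (X (H v) f) f' = fderiv ℂ X (H v) (X (H v) f') f)
    (hrad : ∀ᶠ y in 𝓝 v, fderiv ℂ H y (Q y) = X (H y) y) :
    HasFDerivAt (fun y ↦ fderiv ℂ H y ∘L Q - X (H y))
      (fderiv ℂ (fun y ↦ fderiv ℂ H y ∘L Q - X (H y)) v) v ∧ ∀ f,
    fderiv ℂ (fun y ↦ fderiv ℂ H y ∘L Q - X (H y)) v (Q v) f =
      fderiv ℂ X (H v) ((fderiv ℂ H v ∘L Q - X (H v)) f) v -
        (fderiv ℂ H v ∘L Q - X (H v)) f := by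
  have hd : HasFDerivAt H (fderiv ℂ H v) v := (hH.differentiableAt (by simp)).hasFDerivAt
  have hD : HasFDerivAt (fderiv ℂ H) (fderiv ℂ (fderiv ℂ H) v) v :=
    ((hH.fderiv_right (m := ω) (by simp)).differentiableAt (by simp)).hasFDerivAt
  have hXH : HasFDerivAt (fun y ↦ X (H y)) (fderiv ℂ X (H v) ∘L fderiv ℂ H v) v :=
    hX.hasFDerivAt.comp v hd
  have hsymm := (hH.isSymmSndFDerivAt (by simp)).eq
  have hdef : HasFDerivAt (fun y ↦ fderiv ℂ H y ∘L Q - X (H y)) _ v :=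
    (hD.clm_comp (hasFDerivAt_const Q v)).sub hXH
  have hrel : HasFDerivAt (fun y ↦ fderiv ℂ H y (Q y)) _ v := hD.clm_apply Q.hasFDerivAt
  have hrel' : HasFDerivAt (fun y ↦ X (H y) y) _ v := hXH.clm_apply (hasFDerivAt_id v)
  have hrad' := hrel.unique (hrel'.congr_of_eventuallyEq hrad)
  -- Differentiate the radial equation in the direction `Q f`. Symmetry of the second derivative of
  -- `H` gives the first term of the derivative of the defect, and the commutation hypothesis
  -- exchanges `f` and `v` in the second.
  refine ⟨hdef.differentiableAt.hasFDerivAt, fun f ↦ ?_⟩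
  have h1 := DFunLike.congr_fun hrad' (Q f)
  simp only [_root_.add_apply, ContinuousLinearMap.comp_apply,
    ContinuousLinearMap.flip_apply, ContinuousLinearMap.id_apply, hQ, hXQ] at h1
  have h2 : fderiv ℂ (fun y ↦ fderiv ℂ H y ∘L Q - X (H y)) v (Q v) f =
      fderiv ℂ (fderiv ℂ H) v (Q v) (Q f) - fderiv ℂ X (H v) (fderiv ℂ H v (Q v)) f := by
    rw [hdef.fderiv]
    simp
  rw [h2, hsymm, hrad.self_of_nhds, hcomm v f]
  simp only [_root_.sub_apply, ContinuousLinearMap.comp_apply, map_sub]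
  rw [← sub_eq_zero] at h1 ⊢
  rw [← h1]
  abel

/-- Solutions of the radial equation for the defect vanish. -/
theorem eq_zero_of_radial {T : E → E →L[ℂ] E} {A : E → E →L[ℂ] E →L[ℂ] E} {Q : E →L[ℂ] E}
    (hQ : ∀ v, Q (Q v) = Q v) {v : E} {C : ℝ} (f : E)
    (hT : ∀ t : 𝕀, DifferentiableAt ℂ T (linePath Q v t) ∧
      fderiv ℂ T (linePath Q v t) (Q (linePath Q v t)) f =
        A (linePath Q v t) (T (linePath Q v t) f) (linePath Q v t) - T (linePath Q v t) f)
    (hA : ∀ t : 𝕀, ‖A (linePath Q v t)‖ ≤ C ∧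
      ∀ h g, A (linePath Q v t) h (Q g) = A (linePath Q v t) h g) : T v f = 0 := by
  let line : ℝ → E := fun t ↦ (t : ℂ) • Q v + (v - Q v)
  have hline (t : ℝ) : HasDerivAt line (Q v) t := by
    have h1 : HasDerivAt (fun t : ℝ ↦ (t : ℂ)) 1 t := Complex.ofRealCLM.hasDerivAt
    have h2 := (h1.smul_const (Q v)).add_const (v - Q v)
    rw [one_smul] at h2
    exact h2
  have hl (t : ℝ) (ht : t ∈ 𝕀) : linePath Q v ⟨t, ht⟩ = line t := rfl
  -- The factor `t` absorbs the term `-T f` of the radial equation, leaving a homogeneous linear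
  -- equation, and it makes the initial value zero whatever `T` is at the start of the segment.
  -- Grönwall then gives vanishing.
  have hder (t : ℝ) (ht : t ∈ 𝕀) : HasDerivAt (fun t : ℝ ↦ (t : ℂ) • T (line t) f)
      (A (line t) ((t : ℂ) • T (line t) f) (Q v)) t := by
    obtain ⟨hd, he⟩ := hT ⟨t, ht⟩
    obtain ⟨-, hAQ⟩ := hA ⟨t, ht⟩
    rw [map_linePath hQ] at he
    rw [hl t ht] at hd he hAQ
    have h1 : HasFDerivAt T ((fderiv ℂ T (line t)).restrictScalars ℝ) (line t) :=
      hd.hasFDerivAt.restrictScalars ℝ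
    have h2 : HasDerivAt (fun t : ℝ ↦ T (line t)) (fderiv ℂ T (line t) (Q v)) t :=
      h1.comp_hasDerivAt t (hline t)
    have h3 : HasDerivAt (fun t : ℝ ↦ T (line t) f) (fderiv ℂ T (line t) (Q v) f) t :=
      ((ContinuousLinearMap.apply ℂ E f).restrictScalars ℝ).hasFDerivAt.comp_hasDerivAt t h2
    have h4 : HasDerivAt (fun t : ℝ ↦ (t : ℂ)) 1 t := Complex.ofRealCLM.hasDerivAt
    have h5 : HasDerivAt (fun t : ℝ ↦ (t : ℂ) • T (line t) f) _ t := h4.smul h3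
    convert h5 using 1
    have h6 : A (line t) (T (line t) f) (line t) =
        (t : ℂ) • A (line t) (T (line t) f) (Q v) := by
      rw [← hAQ, ← map_smul]
      congr 1
      rw [← hl t ht, map_linePath hQ]
    simp only [map_smul, _root_.smul_apply] at he ⊢
    rw [he, h6, one_smul]
    abel
  have key := eq_zero_of_abs_deriv_le_mul_abs_self_of_eq_zero_right
    (f := fun t : ℝ ↦ (t : ℂ) • T (line t) f)
    (f' := fun t ↦ A (line t) ((t : ℂ) • T (line t) f) (Q v)) (K := C * ‖Q v‖) (a := 0) (b := 1)
    (fun t ht ↦ (hder t ht).continuousAt.continuousWithinAt)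
    (fun t ht ↦ (hder t ⟨ht.1, ht.2.le⟩).hasDerivWithinAt) (by simp)
    (fun t ht ↦ by
      refine ((A (line t)).le_opNorm₂ _ _).trans ?_
      have : ‖A (line t)‖ ≤ C := (hA ⟨t, ht.1, ht.2.le⟩).1
      calc _ ≤ C * ‖(t : ℂ) • T (line t) f‖ * ‖Q v‖ := by gcongr
        _ = _ := by ring) 1 ⟨zero_le_one, le_rfl⟩
  simpa [line] using key

variable [CompleteSpace E]

/-- **Frobenius theorem**, for commuting fields `u ↦ X u f`: existence of a straightening. -/
theorem exists_straightening {X : E → E →L[ℂ] E} {Q : E →L[ℂ] E} (hX : AnalyticAt ℂ X 0)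
    (hX0 : X 0 = Q) (hQ : ∀ v, Q (Q v) = Q v) (hXQ : ∀ᶠ u in 𝓝 0, ∀ f, X u (Q f) = X u f)
    (hcomm : ∀ᶠ u in 𝓝 0, ∀ f f', fderiv ℂ X u (X u f) f' = fderiv ℂ X u (X u f') f) :
    ∃ H : E → E, ContDiffAt ℂ ω H 0 ∧ H 0 = 0 ∧ HasFDerivAt H (ContinuousLinearMap.id ℂ E) 0 ∧
      ∀ᶠ v in 𝓝 0, ∀ f, fderiv ℂ H v (Q f) = X (H v) f := by
  obtain ⟨b, hb, hb0, hb', hA, hU⟩ := exists_analytic_flow (.id ℂ (E →L[ℂ] E))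
    (G := fun u ↦ X u - Q) Q (hX.sub analyticAt_const) (by simp [hX0])
  have hR := flow_rescale hQ hXQ hb.continuousAt hb0 hA hU
  let ev : C(𝕀, E) →L[ℂ] E := ContinuousMap.evalCLM ℂ 1
  let H : E → E := fun v ↦ v + ev (b v)
  have hH : ContDiffAt ℂ ω H 0 := contDiffAt_id.add
    ((ContinuousLinearMap.contDiff (E := C(𝕀, E)) (F := E) ev).contDiffAt.comp _ hb)
  have hH0 : H 0 = 0 := by simp [H, hb0]
  have hH' : HasFDerivAt H (ContinuousLinearMap.id ℂ E) 0 := by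
    have := (hasFDerivAt_id (𝕜 := ℂ) (0 : E)).add (ev.hasFDerivAt.comp (0 : E) hb')
    rw [ContinuousLinearMap.comp_zero, add_zero] at this
    exact this
  refine ⟨H, hH, hH0, hH', ?_⟩
  have hHt : Filter.Tendsto H (𝓝 0) (𝓝 0) := by
    simpa only [ContinuousAt, hH0] using hH.continuousAt
  have hHe : ∀ᶠ v in 𝓝 0, ContDiffAt ℂ ω H v := hH.eventually (by simp)
  have hrad : ∀ᶠ v in 𝓝 0, fderiv ℂ H v (Q v) = X (H v) v := by
    filter_upwards [hA, hR, hHe] with v hv hv' hHv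
    exact fderiv_time_one (fun _ ↦ rfl) (hHv.differentiableAt (by simp)) hv hv'
  have hXe : ∀ᶠ u in 𝓝 0, AnalyticAt ℂ X u := hX.eventually_analyticAt
  -- Differentiate the identity `X u (Q g) = X u g`.
  have hDXQ : ∀ᶠ u in 𝓝 0, ∀ h g, fderiv ℂ X u h (Q g) = fderiv ℂ X u h g := by
    filter_upwards [hXQ.eventually_nhds, hXe] with u hu hXu h g
    have hd (g : E) : HasFDerivAt (fun y ↦ X y g)
        ((ContinuousLinearMap.apply ℂ E g) ∘L fderiv ℂ X u) u :=
      (ContinuousLinearMap.apply ℂ E g).hasFDerivAt.comp u hXu.differentiableAt.hasFDerivAt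
    exact DFunLike.congr_fun ((hd (Q g)).unique ((hd g).congr_of_eventuallyEq
      (hu.mono fun y hy ↦ hy g))) h
  obtain ⟨C, hC⟩ : ∃ C, ∀ᶠ u in 𝓝 (0 : E), ‖fderiv ℂ X u‖ ≤ C := by
    refine ⟨‖fderiv ℂ X 0‖ + 1, ?_⟩
    have := hX.fderiv.continuousAt.norm
    filter_upwards [this.eventually_lt_const (lt_add_one _)] with u hu using hu.le
  have hgood : ∀ᶠ v in 𝓝 0, (∀ f, DifferentiableAt ℂ (fun y ↦ fderiv ℂ H y ∘L Q - X (H y)) v ∧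
      fderiv ℂ (fun y ↦ fderiv ℂ H y ∘L Q - X (H y)) v (Q v) f =
      fderiv ℂ X (H v) ((fderiv ℂ H v ∘L Q - X (H v)) f) v -
        (fderiv ℂ H v ∘L Q - X (H v)) f) ∧ ‖fderiv ℂ X (H v)‖ ≤ C ∧
      ∀ h g, fderiv ℂ X (H v) h (Q g) = fderiv ℂ X (H v) h g := by
    filter_upwards [hHe, hHt.eventually hXe, hHt.eventually hXQ, hHt.eventually hcomm,
      hrad.eventually_nhds, hHt.eventually hC, hHt.eventually hDXQ] with v h1 h2 h3 h4 h5 h6 h7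
    have := fderiv_defect hQ h1 h2.differentiableAt h3 h4 h5
    exact ⟨fun f ↦ ⟨this.1.differentiableAt, this.2 f⟩, h6, h7⟩
  filter_upwards [eventually_forall_path hgood (linePath Q).continuous.continuousAt
    (map_zero _)] with v hv f
  have := eq_zero_of_radial (T := fun y ↦ fderiv ℂ H y ∘L Q - X (H y))
    (A := fun y ↦ fderiv ℂ X (H y)) (v := v) hQ f (fun t ↦ (hv t).1 f) (fun t ↦ (hv t).2)
  exact sub_eq_zero.1 this

/-- First integrals of the distribution spanned by commuting fields `u ↦ X u f`. -/
theorem exists_first_integral_of_commute {X : E → E →L[ℂ] E} {Q : E →L[ℂ] E}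
    (hX : AnalyticAt ℂ X 0)
    (hX0 : X 0 = Q) (hQ : ∀ v, Q (Q v) = Q v) (hXQ : ∀ᶠ u in 𝓝 0, ∀ f, X u (Q f) = X u f)
    (hcomm : ∀ᶠ u in 𝓝 0, ∀ f f', fderiv ℂ X u (X u f) f' = fderiv ℂ X u (X u f') f) :
    ∃ w : E → E, ContDiffAt ℂ ω w 0 ∧ fderiv ℂ w 0 = ContinuousLinearMap.id ℂ E - Q ∧
      ∀ᶠ u in 𝓝 0, ∀ f, fderiv ℂ w u (X u f) = 0 := by
  obtain ⟨H, hH, hH0, hH', hHX⟩ := exists_straightening hX hX0 hQ hXQ hcomm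
  have hHe : HasFDerivAt H ((ContinuousLinearEquiv.refl ℂ E : E ≃L[ℂ] E) : E →L[ℂ] E) 0 := hH'
  have hω : (ω : WithTop ℕ∞) ≠ 0 := by simp
  have hs := hH.hasStrictFDerivAt' hHe hω
  let R : E → E := hH.localInverse hHe hω
  have hR : ContDiffAt ℂ ω R 0 := by
    have := hH.to_localInverse hHe hω
    rwa [hH0] at this
  have hR0 : R 0 = 0 := by
    have := hH.localInverse_apply_image hHe hω
    rwa [hH0] at this
  have hRt : Filter.Tendsto R (𝓝 0) (𝓝 0) := by
    simpa only [ContinuousAt, hR0] using hR.continuousAt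
  have hleft : ∀ᶠ v in 𝓝 0, R (H v) = v := hs.eventually_left_inverse
  have hright : ∀ᶠ u in 𝓝 0, H (R u) = u := by
    have := hs.eventually_right_inverse
    rwa [hH0] at this
  have hHd : ∀ᶠ v in 𝓝 0, DifferentiableAt ℂ H v :=
    (hH.eventually (by simp)).mono fun v hv ↦ hv.differentiableAt hω
  have hRd : ∀ᶠ u in 𝓝 0, DifferentiableAt ℂ R u :=
    (hR.eventually (by simp)).mono fun v hv ↦ hv.differentiableAt hω
  have hchain : ∀ᶠ u in 𝓝 0, ∀ f, fderiv ℂ R u (fderiv ℂ H (R u) f) = f := by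
    filter_upwards [hRt.eventually hleft.eventually_nhds, hright, hRt.eventually hHd, hRd]
      with u h1 h2 h3 h4 f
    have h4' : HasFDerivAt R (fderiv ℂ R u) (H (R u)) := by rw [h2]; exact h4.hasFDerivAt
    have h5 := (h4'.comp (R u) h3.hasFDerivAt).unique
      ((hasFDerivAt_id (R u)).congr_of_eventuallyEq h1)
    exact DFunLike.congr_fun h5 f
  let P : E →L[ℂ] E := ContinuousLinearMap.id ℂ E - Q
  have hw (u : E) (hu : DifferentiableAt ℂ R u) :
      fderiv ℂ (fun u ↦ P (R u)) u = P ∘L fderiv ℂ R u :=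
    (P.hasFDerivAt.comp u hu.hasFDerivAt).fderiv
  -- `H` carries the constant fields `Q f` to the fields `X u f`, so the derivative of its inverse
  -- `R` sends `X u f` to `Q f`, which `P = 1 - Q` kills.
  refine ⟨fun u ↦ P (R u), P.contDiff.contDiffAt.comp _ hR, ?_, ?_⟩
  · rw [hw 0 hRd.self_of_nhds]
    ext f
    have := hchain.self_of_nhds f
    rw [hR0, hH'.fderiv, ContinuousLinearMap.id_apply] at this
    rw [ContinuousLinearMap.comp_apply, this]
  · filter_upwards [hchain, hright, hRd, hRt.eventually hHX] with u h1 h2 h3 h4 f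
    rw [hw u h3, ContinuousLinearMap.comp_apply]
    have h5 := h4 f
    rw [h2] at h5
    rw [← h5, h1]
    simp [P, hQ]

end FirstIntegral

open Topology

/-! ### The Frobenius theorem for involutive fields of projections -/

section Frobenius

theorem exists_isOpen_subset {E : Type*} [TopologicalSpace E] {p : E → Prop} {O : Set E} (hO : IsOpen O) {u₀ : E} (hu₀ : u₀ ∈ O)
    (hp : ∀ᶠ u in 𝓝 u₀, p u) : ∃ O' ⊆ O, IsOpen O' ∧ u₀ ∈ O' ∧ ∀ u ∈ O', p u := by
  obtain ⟨t, ht, hto, hut⟩ := eventually_nhds_iff.1 (hp.and (hO.mem_nhds hu₀))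
  exact ⟨t, fun u hu ↦ (ht u hu).2, hto, hut, fun u hu ↦ (ht u hu).1⟩

variable {E : Type*} [NormedAddCommGroup E] [NormedSpace ℂ E]

/-- Otherwise `v = (S - T) v` would be strictly shorter than itself. The lemma replaces dimension
counts when nearby operators are compared. -/
theorem eq_zero_of_norm_sub_lt_one {S T : E →L[ℂ] E} (h : ‖S - T‖ < 1) {v : E} (hS : S v = v)
    (hT : T v = 0) : v = 0 := by
  have h1 : ‖v‖ ≤ ‖S - T‖ * ‖v‖ := by
    have := (S - T).le_opNorm v
    rwa [_root_.sub_apply, hS, hT, sub_zero] at this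
  by_contra hv
  nlinarith [norm_pos_iff.2 hv]

variable [CompleteSpace E]

/-- A field of operators that compresses to the identity of the range of a projection `p` at a
point is invertible there, nearby and analytically. -/
theorem exists_compressed_inverse {A : E → E →L[ℂ] E} {p : E →L[ℂ] E} {u₀ : E}
    (hA : ContDiffAt ℂ ω A u₀) (hp : p * p = p) (hpA : p * A u₀ * p = p) :
    ∃ S : E → E →L[ℂ] E, ContDiffAt ℂ ω S u₀ ∧ S u₀ = p ∧
      ∀ᶠ u in 𝓝 u₀, p * S u = S u ∧ S u * p = S u ∧ p * A u * S u = p := by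
  -- Adding the identity on the kernel of `p` makes the compression block diagonal. It equals `1` at
  -- `u₀`, so it is invertible nearby, and its inverse commutes with `p`.
  let R : E → E →L[ℂ] E := fun u ↦ p * A u * p + (1 - p)
  have hR : ContDiffAt ℂ ω R u₀ :=
    ((contDiffAt_const.mul hA).mul contDiffAt_const).add contDiffAt_const
  have hR0 : R u₀ = 1 := by simp [R, hpA]
  have hRi : ContDiffAt ℂ ω (fun u ↦ Ring.inverse (R u)) u₀ := by
    refine ContDiffAt.comp u₀ (g := Ring.inverse) ?_ hR
    rw [hR0]
    exact contDiffAt_ringInverse ℂ (1 : (E →L[ℂ] E)ˣ)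
  have hunit : ∀ᶠ u in 𝓝 u₀, IsUnit (R u) := by
    refine hR.continuousAt.eventually ?_
    rw [hR0]
    exact Units.isOpen.mem_nhds isUnit_one
  refine ⟨fun u ↦ Ring.inverse (R u) * p, hRi.mul contDiffAt_const, by simp [hR0], ?_⟩
  filter_upwards [hunit] with u hu
  have h1 : p * R u = R u * p := by
    simp only [R, mul_add, add_mul, mul_sub, sub_mul, mul_one, one_mul, hp, ← mul_assoc]
    rw [mul_assoc (p * A u) p p, hp]
  have h2 : p * Ring.inverse (R u) = Ring.inverse (R u) * p := by
    calc p * Ring.inverse (R u) = Ring.inverse (R u) * R u * (p * Ring.inverse (R u)) := by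
          rw [Ring.inverse_mul_cancel _ hu, one_mul]
      _ = Ring.inverse (R u) * (p * R u) * Ring.inverse (R u) := by rw [h1]; noncomm_ring
      _ = Ring.inverse (R u) * p * (R u * Ring.inverse (R u)) := by noncomm_ring
      _ = _ := by rw [Ring.mul_inverse_cancel _ hu, mul_one]
  refine ⟨by rw [← mul_assoc, h2, mul_assoc, hp], by rw [mul_assoc, hp], ?_⟩
  have h3 : p * A u * p = p * R u := by
    simp only [R, mul_add, mul_sub, mul_one, hp, sub_self, add_zero, ← mul_assoc]
  calc p * A u * (Ring.inverse (R u) * p) = p * A u * (p * Ring.inverse (R u) * p) := by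
        rw [h2, mul_assoc _ p p, hp]
    _ = p * A u * p * Ring.inverse (R u) * p := by noncomm_ring
    _ = p * (R u * Ring.inverse (R u)) * p := by rw [h3]; noncomm_ring
    _ = p := by rw [Ring.mul_inverse_cancel _ hu, mul_one, hp]

/-- A field of operators `T` on `O` has integrable `μ`-eigenspaces: the Lie bracket of analytic
`μ`-eigenfields is again one. -/
def EigenInvolutive (T : E → E →L[ℂ] E) (μ : ℂ) (O : Set E) : Prop :=
  ∀ O' ⊆ O, IsOpen O' → ∀ X Y : E → E, ContDiffOn ℂ ω X O' → ContDiffOn ℂ ω Y O' →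
    (∀ u ∈ O', T u (X u) = μ • X u) → (∀ u ∈ O', T u (Y u) = μ • Y u) →
    ∀ u ∈ O', T u (VectorField.lieBracket ℂ X Y u) = μ • VectorField.lieBracket ℂ X Y u

/-- **Frobenius theorem**: first integrals of the distribution `range Q(u)`, for an analytic
field `Q` of projections with involutive range. -/
theorem exists_first_integral {Q : E → E →L[ℂ] E} {O : Set E} (hO : IsOpen O) {u₀ : E}
    (hu₀ : u₀ ∈ O) (hQ : ContDiffOn ℂ ω Q O) (hQQ : ∀ u ∈ O, ∀ v, Q u (Q u v) = Q u v)
    (hinv : EigenInvolutive Q 1 O) :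
    ∃ w : E → E, ContDiffAt ℂ ω w u₀ ∧ fderiv ℂ w u₀ = ContinuousLinearMap.id ℂ E - Q u₀ ∧
      ∀ᶠ u in 𝓝 u₀, ∀ f, fderiv ℂ w u (Q u f) = 0 := by
  have hQ0 : ContDiffAt ℂ ω Q u₀ := hQ.contDiffAt (hO.mem_nhds hu₀)
  set p := Q u₀ with hp
  have hpp : p * p = p := by ext v; exact hQQ u₀ hu₀ v
  obtain ⟨S, hS, hS0, hSe⟩ := exists_compressed_inverse hQ0 hpp (by rw [← hp, hpp, hpp])
  -- Frame of the range of `Q` normalised by `p * X u = p`, as if by Gaussian elimination; this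
  -- normalisation forces the fields to commute.
  let X : E → E →L[ℂ] E := fun u ↦ Q u * S u
  have hX : ContDiffAt ℂ ω X u₀ := hQ0.mul hS
  have hX0 : X u₀ = p := by simp only [X, hS0, ← hp, hpp]
  have hclose : ∀ᶠ u in 𝓝 u₀, ‖Q u - p‖ < 1 := by
    have := (hQ0.continuousAt.sub (continuousAt_const (y := p))).norm
    refine this.eventually_lt_const ?_
    simp [hp]
  have hXe : ∀ᶠ u in 𝓝 u₀, X u * p = X u ∧ p * X u = p ∧ Q u * X u = X u := by
    filter_upwards [hSe, hO.mem_nhds hu₀] with u ⟨h1, h2, h3⟩ hu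
    refine ⟨by rw [mul_assoc, h2], by rw [← mul_assoc, h3], ?_⟩
    ext v
    exact hQQ u hu _
  have hXc : ∀ᶠ u in 𝓝 u₀, ContDiffAt ℂ ω X u := hX.eventually (by simp)
  have hcomm : ∀ᶠ u in 𝓝 u₀, ∀ f f', fderiv ℂ X u (X u f) f' = fderiv ℂ X u (X u f') f := by
    obtain ⟨O', hO'O, hO', hu₀', hO'p⟩ :=
      exists_isOpen_subset hO hu₀ ((hXe.and hXc).and hclose)
    filter_upwards [hO'.mem_nhds hu₀'] with u hu f f'
    have hXf (f : E) : ContDiffOn ℂ ω (fun u ↦ X u f) O' := fun u hu ↦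
      ((hO'p u hu).1.2.clm_apply contDiffAt_const).contDiffWithinAt
    have hder (f : E) : HasFDerivAt (fun u ↦ X u f)
        ((ContinuousLinearMap.apply ℂ E f) ∘L fderiv ℂ X u) u :=
      (ContinuousLinearMap.apply ℂ E f).hasFDerivAt.comp u
        ((hO'p u hu).1.2.differentiableAt (by simp)).hasFDerivAt
    have hQd := hinv O' hO'O hO' _ _ (hXf f) (hXf f')
      (fun y hy ↦ by rw [one_smul]; exact DFunLike.congr_fun (hO'p y hy).1.1.2.2 f)
      (fun y hy ↦ by rw [one_smul]; exact DFunLike.congr_fun (hO'p y hy).1.1.2.2 f') u hu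
    rw [one_smul] at hQd
    have hd : VectorField.lieBracket ℂ (fun u ↦ X u f) (fun u ↦ X u f') u =
        fderiv ℂ X u (X u f) f' - fderiv ℂ X u (X u f') f := by
      rw [VectorField.lieBracket_eq]
      simp only [(hder f).fderiv, (hder f').fderiv]
      rfl
    -- Since `p (X y g)` is constant, `p` kills the bracket, while involutivity says that `Q u`
    -- fixes it. As `Q u` is close to `p`, the bracket is zero.
    have hpd (h g : E) : p (fderiv ℂ X u h g) = 0 := by
      have h1 : HasFDerivAt (fun y ↦ p (X y g))
          (p ∘L (ContinuousLinearMap.apply ℂ E g) ∘L fderiv ℂ X u) u :=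
        p.hasFDerivAt.comp u (hder g)
      have h2 : HasFDerivAt (fun y ↦ p (X y g)) (0 : E →L[ℂ] E) u := by
        refine (hasFDerivAt_const (p g) u).congr_of_eventuallyEq ?_
        filter_upwards [hO'.mem_nhds hu] with y hy
        exact DFunLike.congr_fun (hO'p y hy).1.1.2.1 g
      exact DFunLike.congr_fun (h1.unique h2) h
    rw [hd] at hQd
    exact sub_eq_zero.1 (eq_zero_of_norm_sub_lt_one (hO'p u hu).2 hQd
      (by rw [map_sub, hpd, hpd, sub_zero]))
  have htrans : Filter.Tendsto (fun v : E ↦ u₀ + v) (𝓝 0) (𝓝 u₀) := by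
    have : ContinuousAt (fun v : E ↦ u₀ + v) 0 := by fun_prop
    simpa only [ContinuousAt, add_zero] using this
  have htrans' : Filter.Tendsto (fun u : E ↦ u - u₀) (𝓝 u₀) (𝓝 0) := by
    have : ContinuousAt (fun u : E ↦ u - u₀) u₀ := by fun_prop
    simpa only [ContinuousAt, sub_self] using this
  have hX' : ContDiffAt ℂ ω (fun v ↦ X (u₀ + v)) 0 := by
    refine ContDiffAt.comp (0 : E) (g := X) (by rwa [add_zero]) ?_
    fun_prop
  obtain ⟨w, hw, hw0, hwX⟩ := exists_first_integral_of_commute (X := fun v ↦ X (u₀ + v)) (Q := p)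
    (hX'.analyticAt) (by rw [add_zero, hX0])
    (fun v ↦ DFunLike.congr_fun hpp v)
    (htrans.eventually (hXe.mono fun u hu f ↦ DFunLike.congr_fun hu.1 f))
    (by
      simp only [fderiv_comp_add_left]
      exact htrans.eventually hcomm)
  refine ⟨fun u ↦ w (u - u₀), ?_, ?_, ?_⟩
  · refine ContDiffAt.comp u₀ (g := w) (by rwa [sub_self]) ?_
    fun_prop
  · rw [fderiv_comp_sub, sub_self, hw0]
  · filter_upwards [htrans'.eventually hwX, hXe, hclose, hO.mem_nhds hu₀]
      with u h1 ⟨_, h3, h4⟩ h5 hu f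
    -- The range of `Q u` is no larger than that of `X u`: this difference is fixed by `Q u` and
    -- killed by `p`.
    have h6 : Q u f - X u (Q u f) = 0 := by
      refine eq_zero_of_norm_sub_lt_one h5 ?_ ?_
      · rw [map_sub, hQQ u hu]
        congr 1
        exact DFunLike.congr_fun h4 _
      · rw [map_sub, sub_eq_zero]
        exact (DFunLike.congr_fun h3 _).symm
    rw [fderiv_comp_sub, sub_eq_zero.1 h6]
    have := h1 (Q u f)
    rwa [add_sub_cancel] at this

end Frobenius

open Topology VectorField

/-! ### Eigenspaces of a complex structure and adapted frames -/

section LocalTetrad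

variable {E : Type*} [NormedAddCommGroup E] [NormedSpace ℂ E]

/-- Half of the eigenvectors of `K` belong to each eigenvalue, if `K` anticommutes with `I`. -/
theorem exists_linearIndependent_eigenvectors {E : Type*} [AddCommGroup E] [Module ℂ E]
    (hE : Module.finrank ℂ E = 4) {I K : E →ₗ[ℂ] E} (hII : ∀ v, I (I v) = -v)
    (hKK : ∀ v, K (K v) = -v) (hIK : ∀ v, I (K v) = -K (I v)) :
    ∃ e : Fin 2 → E, LinearIndependent ℂ e ∧ ∀ A, K (e A) = Complex.I • e A := by
  have : FiniteDimensional ℂ E := Module.finite_of_finrank_pos (by omega)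
  obtain ⟨f, hf⟩ : ∃ f : E →ₗ[ℂ] E, ∀ v, f v = K v - Complex.I • v :=
    ⟨K - Complex.I • LinearMap.id, fun _ ↦ rfl⟩
  have hker (v : E) : v ∈ LinearMap.ker f ↔ K v = Complex.I • v := by
    rw [LinearMap.mem_ker, hf, sub_eq_zero]
  have hran (v : E) : v ∈ LinearMap.range f ↔ K v = -(Complex.I • v) := by
    constructor
    · rintro ⟨y, rfl⟩
      rw [hf, map_sub, map_smul, hKK, smul_sub, smul_smul, Complex.I_mul_I]
      module
    · intro h
      refine ⟨(Complex.I / 2) • v, ?_⟩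
      rw [hf, map_smul, h]
      match_scalars
      linear_combination (-1 : ℂ) * Complex.I_mul_I
  obtain ⟨J, hJ⟩ : ∃ J : E ≃ₗ[ℂ] E, ∀ v, J v = I v :=
    ⟨LinearEquiv.ofLinearMap I (-I) (by ext; simp [hII]) (by ext; simp [hII]), fun _ ↦ rfl⟩
  -- The kernel and range of `f` are the eigenspaces for `i` and `-i`. The invertible map `I`
  -- exchanges them, so both have dimension two.
  have h1 : (LinearMap.ker f).map (J : E →ₗ[ℂ] E) ≤ LinearMap.range f := by
    rintro _ ⟨v, hv, rfl⟩
    have hv' := (hker v).1 hv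
    rw [hran]
    rw [LinearEquiv.coe_coe, hJ, ← map_smul, ← hv', hIK, neg_neg]
  have h2 : (LinearMap.range f).map (J : E →ₗ[ℂ] E) ≤ LinearMap.ker f := by
    rintro _ ⟨v, hv, rfl⟩
    have hv' := (hran v).1 hv
    rw [hker]
    rw [LinearEquiv.coe_coe, hJ, ← map_smul, ← neg_neg (Complex.I • v), ← hv', map_neg, hIK, neg_neg]
  have h3 := Submodule.finrank_mono h1
  have h4 := Submodule.finrank_mono h2
  have h5 := f.finrank_range_add_finrank_ker
  rw [LinearEquiv.finrank_map_eq] at h3 h4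
  have h6 : Module.finrank ℂ (LinearMap.ker f) = 2 := by omega
  obtain ⟨b⟩ : Nonempty (Module.Basis (Fin 2) ℂ (LinearMap.ker f)) :=
    ⟨Module.finBasisOfFinrankEq ℂ (LinearMap.ker f) h6⟩
  exact ⟨fun A ↦ b A, b.linearIndependent.map' _ (Submodule.ker_subtype _),
    fun A ↦ (hker _).1 (b A).2⟩

/-- The second-derivative terms cancel by symmetry. Consequently, if `dw` is constant on two fields,
it kills their bracket. -/
theorem fderiv_lieBracket {w : E → E} {X Y : E → E} {u : E} (hw : ContDiffAt ℂ ω w u)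
    (hX : DifferentiableAt ℂ X u) (hY : DifferentiableAt ℂ Y u) :
    fderiv ℂ w u (lieBracket ℂ X Y u) =
      fderiv ℂ (fun y ↦ fderiv ℂ w y (Y y)) u (X u) -
        fderiv ℂ (fun y ↦ fderiv ℂ w y (X y)) u (Y u) := by
  have hD : HasFDerivAt (fderiv ℂ w) (fderiv ℂ (fderiv ℂ w) u) u :=
    ((hw.fderiv_right (m := ω) (by simp)).differentiableAt (by simp)).hasFDerivAt
  have hsymm := (hw.isSymmSndFDerivAt (by simp)).eq
  have h1 : HasFDerivAt (fun y ↦ fderiv ℂ w y (Y y)) _ u := hD.clm_apply hY.hasFDerivAt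
  have h2 : HasFDerivAt (fun y ↦ fderiv ℂ w y (X y)) _ u := hD.clm_apply hX.hasFDerivAt
  rw [h1.fderiv, h2.fderiv, lieBracket_eq]
  simp only [_root_.add_apply, ContinuousLinearMap.comp_apply, ContinuousLinearMap.flip_apply,
    map_sub]
  rw [hsymm]
  abel

/-- The eigenspace projection `(1 - μ K) / 2`, onto `K = -μ⁻¹`. -/
def eigenProj (K : E → E →L[ℂ] E) (μ : ℂ) (u : E) : E →L[ℂ] E :=
  (2⁻¹ : ℂ) • (ContinuousLinearMap.id ℂ E - μ • K u)

theorem eigenProj_apply (K : E → E →L[ℂ] E) (μ : ℂ) (u v : E) :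
    eigenProj K μ u v = (2⁻¹ : ℂ) • (v - μ • K u v) := rfl

theorem map_eigenProj {K : E → E →L[ℂ] E} {μ : ℂ} (hμ : μ * μ = -1) {u : E}
    (hK : ∀ v, K u (K u v) = -v) (v : E) :
    K u (eigenProj K μ u v) = μ • eigenProj K μ u v := by
  have h : μ • (2⁻¹ : ℂ) • (v - μ • K u v) = (2⁻¹ : ℂ) • (μ • v - (μ * μ) • K u v) := by module
  rw [eigenProj_apply, map_smul, map_sub, map_smul, hK, h, hμ]
  module

theorem eigenProj_eq_self_iff {K : E → E →L[ℂ] E} {μ : ℂ} (hμ : μ * μ = -1) {u v : E} :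
    eigenProj K μ u v = v ↔ K u v = μ • v := by
  rw [eigenProj_apply]
  constructor
  · intro h
    have h1 : v - μ • K u v = (2 : ℂ) • v := by
      rw [← h, smul_smul, h]; norm_num
    have h2 : μ • K u v = -v := by
      have : μ • K u v = v - (v - μ • K u v) := by abel
      rw [this, h1, two_smul]; abel
    have h3 := congrArg (fun x ↦ -(μ • x)) h2
    simp only [smul_smul, hμ, smul_neg, neg_neg, neg_one_smul] at h3
    exact h3
  · intro h
    rw [h, smul_smul, hμ]
    module

theorem eigenProj_idem {K : E → E →L[ℂ] E} {μ : ℂ} (hμ : μ * μ = -1) {u : E}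
    (hK : ∀ v, K u (K u v) = -v) (v : E) :
    eigenProj K μ u (eigenProj K μ u v) = eigenProj K μ u v :=
  (eigenProj_eq_self_iff hμ).2 (map_eigenProj hμ hK v)

theorem id_sub_eigenProj (K : E → E →L[ℂ] E) (μ : ℂ) (u : E) :
    ContinuousLinearMap.id ℂ E - eigenProj K μ u = eigenProj K (-μ) u := by
  ext v
  rw [_root_.sub_apply, eigenProj_apply, eigenProj_apply, ContinuousLinearMap.id_apply]
  module

theorem contDiffOn_eigenProj {K : E → E →L[ℂ] E} {O : Set E} (hK : ContDiffOn ℂ ω K O) (μ : ℂ) :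
    ContDiffOn ℂ ω (eigenProj K μ) O :=
  (contDiffOn_const.sub (hK.const_smul μ)).const_smul _

theorem EigenInvolutive.eigenProj {K : E → E →L[ℂ] E} {μ : ℂ} {O : Set E} (hμ : μ * μ = -1)
    (h : EigenInvolutive K μ O) : EigenInvolutive (eigenProj K μ) 1 O := by
  intro O' hO'O hO' X Y hX hY hKX hKY u hu
  rw [one_smul, eigenProj_eq_self_iff hμ]
  refine h O' hO'O hO' X Y hX hY (fun y hy ↦ ?_) (fun y hy ↦ ?_) u hu
  · rw [← eigenProj_eq_self_iff hμ, hKX y hy, one_smul]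
  · rw [← eigenProj_eq_self_iff hμ, hKY y hy, one_smul]

variable [CompleteSpace E]

/-- Frames of the `i`-eigenspaces of `K` adapted to the first integrals of the other
eigenspaces. -/
theorem exists_adapted_frame {K : E → E →L[ℂ] E} {O : Set E} (hO : IsOpen O) {u₀ : E}
    (hu₀ : u₀ ∈ O) (hK : ContDiffOn ℂ ω K O) (hKK : ∀ u ∈ O, ∀ v, K u (K u v) = -v)
    (hinv : EigenInvolutive K (-Complex.I) O) :
    ∃ (O' : Set E) (w : E → E) (Z : E → E →L[ℂ] E), O' ⊆ O ∧ IsOpen O' ∧ u₀ ∈ O' ∧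
      ContDiffOn ℂ ω w O' ∧ ContDiffOn ℂ ω Z O' ∧ ∀ u ∈ O',
        (∀ v, K u (Z u v) = Complex.I • Z u v) ∧
        (∀ v, K u v = -Complex.I • v → fderiv ℂ w u v = 0) ∧
        (∀ v, K u v = Complex.I • v → fderiv ℂ w u v = 0 → v = 0) ∧
        (∀ v, fderiv ℂ w u (Z u v) = eigenProj K Complex.I u₀ v) := by
  have hi : Complex.I * Complex.I = -1 := Complex.I_mul_I
  have hi' : -Complex.I * -Complex.I = -1 := by simp
  set p := eigenProj K Complex.I u₀ with hp
  obtain ⟨w₀, hw₀, hw₀', hwQ⟩ := exists_first_integral hO hu₀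
    (contDiffOn_eigenProj hK (-Complex.I)) (fun u hu ↦ eigenProj_idem hi' (hKK u hu))
    (EigenInvolutive.eigenProj hi' hinv)
  rw [id_sub_eigenProj, neg_neg, ← hp] at hw₀'
  have hpp : p * p = p := by ext v; exact eigenProj_idem hi (hKK u₀ hu₀) v
  -- Composing with `p` confines the values of `dw` to the range of `p` at every point and leaves
  -- its value at `u₀` equal to `p`.
  let w : E → E := fun u ↦ p (w₀ u)
  have hw : ContDiffAt ℂ ω w u₀ := p.contDiff.contDiffAt.comp _ hw₀
  have hfw : ∀ᶠ u in 𝓝 u₀, fderiv ℂ w u = p * fderiv ℂ w₀ u := by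
    filter_upwards [hw₀.eventually (by simp)] with u hu
    exact (p.hasFDerivAt.comp u (hu.differentiableAt (by simp)).hasFDerivAt).fderiv
  have hDw : ContDiffAt ℂ ω (fderiv ℂ w) u₀ := hw.fderiv_right (m := ω) (by simp)
  have hP : ContDiffAt ℂ ω (eigenProj K Complex.I) u₀ :=
    (contDiffOn_eigenProj hK _).contDiffAt (hO.mem_nhds hu₀)
  have hw' : fderiv ℂ w u₀ = p := by rw [hfw.self_of_nhds, hw₀', hpp]
  obtain ⟨S, hS, hS0, hSe⟩ := exists_compressed_inverse (A := fun u ↦ fderiv ℂ w u *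
    eigenProj K Complex.I u) (hDw.mul hP) hpp (by rw [hw', ← hp, hpp, hpp, hpp])
  -- This closeness makes `dw` injective on the eigenspace `K = i`.
  have hclose : ∀ᶠ u in 𝓝 u₀, ‖eigenProj K Complex.I u - fderiv ℂ w u‖ < 1 := by
    have := (hP.continuousAt.sub hDw.continuousAt).norm
    refine this.eventually_lt_const ?_
    change ‖eigenProj K Complex.I u₀ - fderiv ℂ w u₀‖ < 1
    rw [hw', ← hp, sub_self, norm_zero]
    exact one_pos
  have hZ : ContDiffAt ℂ ω (fun u ↦ eigenProj K Complex.I u * S u) u₀ := hP.mul hS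
  obtain ⟨O', hO'O, hO', hu₀', h⟩ := exists_isOpen_subset hO hu₀
    ((((hw.eventually (by simp)).and (hZ.eventually (by simp))).and (hwQ.and hfw)).and
      (hSe.and hclose))
  refine ⟨O', w, fun u ↦ eigenProj K Complex.I u * S u, hO'O, hO', hu₀',
    fun u hu ↦ (h u hu).1.1.1.contDiffWithinAt, fun u hu ↦ (h u hu).1.1.2.contDiffWithinAt,
    fun u hu ↦ ?_⟩
  obtain ⟨⟨-, h3, h4⟩, ⟨-, -, h7⟩, h8⟩ := h u hu
  have hu' := hO'O hu
  refine ⟨fun v ↦ map_eigenProj hi (hKK u hu') _, fun v hv ↦ ?_, fun v hv hwv ↦ ?_, fun v ↦ ?_⟩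
  · rw [h4]
    have := h3 v
    rw [(eigenProj_eq_self_iff hi').2 hv] at this
    change p (fderiv ℂ w₀ u v) = 0
    rw [this, map_zero]
  · exact eq_zero_of_norm_sub_lt_one h8 ((eigenProj_eq_self_iff hi).2 hv) hwv
  · have h9 := DFunLike.congr_fun h7 v
    rw [h4] at h9 ⊢
    simp only [← mul_assoc, hpp] at h9
    exact h9

end LocalTetrad

open Topology VectorField

/-! ### Tetrads in coordinates that satisfy the commutator equations -/

section LocalTetrad

variable {E : Type*} [NormedAddCommGroup E] [NormedSpace ℂ E]

theorem lieBracket_pencil {X₀ X₁ Y₀ Y₁ : E → E} {u : E} (hX₀ : DifferentiableAt ℂ X₀ u)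
    (hX₁ : DifferentiableAt ℂ X₁ u) (hY₀ : DifferentiableAt ℂ Y₀ u)
    (hY₁ : DifferentiableAt ℂ Y₁ u) (c : ℂ) :
    lieBracket ℂ (fun y ↦ X₀ y + c • X₁ y) (fun y ↦ Y₀ y + c • Y₁ y) u =
      lieBracket ℂ X₀ Y₀ u + c • (lieBracket ℂ X₀ Y₁ u + lieBracket ℂ X₁ Y₀ u) +
        (c * c) • lieBracket ℂ X₁ Y₁ u := by
  have hX : HasFDerivAt (fun y ↦ X₀ y + c • X₁ y) _ u :=
    hX₀.hasFDerivAt.add (hX₁.hasFDerivAt.const_smul c)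
  have hY : HasFDerivAt (fun y ↦ Y₀ y + c • Y₁ y) _ u :=
    hY₀.hasFDerivAt.add (hY₁.hasFDerivAt.const_smul c)
  simp only [lieBracket_eq, hX.fderiv, hY.fderiv, _root_.add_apply, _root_.smul_apply, map_add,
    map_smul]
  module

variable [CompleteSpace E]

/-- The local existence of tetrads that satisfy the commutator equations, for an integrable pair
of anticommuting complex structures. -/
theorem exists_local_tetrad (hE : Module.finrank ℂ E = 4) {I K : E → E →L[ℂ] E} {O : Set E}
    (hO : IsOpen O) {u₀ : E} (hu₀ : u₀ ∈ O) (hI : ContDiffOn ℂ ω I O) (hK : ContDiffOn ℂ ω K O)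
    (hII : ∀ u ∈ O, ∀ v, I u (I u v) = -v) (hKK : ∀ u ∈ O, ∀ v, K u (K u v) = -v)
    (hIK : ∀ u ∈ O, ∀ v, I u (K u v) = -K u (I u v))
    (hK₁ : EigenInvolutive K Complex.I O) (hK₂ : EigenInvolutive K (-Complex.I) O)
    (hI₁ : EigenInvolutive I Complex.I O) (hI₂ : EigenInvolutive I (-Complex.I) O) :
    ∃ (O' : Set E) (V : Fin 2 → Fin 2 → E → E), O' ⊆ O ∧ IsOpen O' ∧ u₀ ∈ O' ∧
      (∀ A B, ContDiffOn ℂ ω (V A B) O') ∧ ∀ u ∈ O',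
        (∀ A, K u (V A 1 u) = Complex.I • V A 1 u) ∧
        (∀ A, I u (V A 1 u) = Complex.I • V A 0 u) ∧
        LinearIndependent ℂ (fun p : Fin 2 × Fin 2 ↦ V p.1 p.2 u) ∧
        lieBracket ℂ (V 0 0) (V 1 0) u = 0 ∧
        lieBracket ℂ (V 0 0) (V 1 1) u + lieBracket ℂ (V 0 1) (V 1 0) u = 0 ∧
        lieBracket ℂ (V 0 1) (V 1 1) u = 0 := by
  have hi : Complex.I * Complex.I = -1 := Complex.I_mul_I
  obtain ⟨O', w, Z, hO'O, hO', hu₀', hw, hZ, h⟩ := exists_adapted_frame hO hu₀ hK hKK hK₂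
  obtain ⟨e, he, heK⟩ := exists_linearIndependent_eigenvectors hE (I := (I u₀ : E →ₗ[ℂ] E))
    (K := (K u₀ : E →ₗ[ℂ] E)) (hII u₀ hu₀) (hKK u₀ hu₀) (hIK u₀ hu₀)
  replace heK (A : Fin 2) : eigenProj K Complex.I u₀ (e A) = e A :=
    (eigenProj_eq_self_iff hi).2 (heK A)
  obtain ⟨X, hX⟩ : ∃ X : Fin 2 → E → E, ∀ A u, X A u = Z u (e A) := ⟨_, fun _ _ ↦ rfl⟩
  obtain ⟨Y, hY⟩ : ∃ Y : Fin 2 → E → E, ∀ A u, Y A u = -Complex.I • I u (X A u) :=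
    ⟨_, fun _ _ ↦ rfl⟩
  have hXc (A : Fin 2) : ContDiffOn ℂ ω (X A) O' :=
    (hZ.clm_apply contDiffOn_const).congr fun u _ ↦ hX A u
  have hYc (A : Fin 2) : ContDiffOn ℂ ω (Y A) O' :=
    (((hI.mono hO'O).clm_apply (hXc A)).const_smul (-Complex.I)).congr fun u _ ↦ hY A u
  have hXd (A : Fin 2) {u : E} (hu : u ∈ O') : DifferentiableAt ℂ (X A) u :=
    ((hXc A).contDiffAt (hO'.mem_nhds hu)).differentiableAt (by simp)
  have hYd (A : Fin 2) {u : E} (hu : u ∈ O') : DifferentiableAt ℂ (Y A) u :=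
    ((hYc A).contDiffAt (hO'.mem_nhds hu)).differentiableAt (by simp)
  have hKX (A : Fin 2) {u : E} (hu : u ∈ O') : K u (X A u) = Complex.I • X A u := by
    rw [hX]; exact (h u hu).1 _
  have hIX (A : Fin 2) {u : E} : I u (X A u) = Complex.I • Y A u := by
    rw [hY, smul_smul, mul_neg, hi, neg_neg, one_smul]
  have hIY (A : Fin 2) {u : E} (hu : u ∈ O') : I u (Y A u) = Complex.I • X A u := by
    rw [hY, map_smul, hII u (hO'O hu), neg_smul_neg]
  have hKY (A : Fin 2) {u : E} (hu : u ∈ O') : K u (Y A u) = -Complex.I • Y A u := by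
    have := hIK u (hO'O hu) (X A u)
    rw [hKX A hu, hIX, map_smul, hIX, map_smul] at this
    have h2 := congrArg (fun v ↦ Complex.I • v) this
    simp only [smul_smul, smul_neg, hi, neg_smul, one_smul, neg_neg] at h2
    rw [← h2, neg_smul]
  have hwX (A : Fin 2) {u : E} (hu : u ∈ O') : fderiv ℂ w u (X A u) = e A := by
    rw [hX, (h u hu).2.2.2, heK]
  have hwY (A : Fin 2) {u : E} (hu : u ∈ O') : fderiv ℂ w u (Y A u) = 0 :=
    (h u hu).2.1 _ (hKY A hu)
  have hwXe (A : Fin 2) {u : E} (hu : u ∈ O') :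
      fderiv ℂ (fun y ↦ fderiv ℂ w y (X A y)) u = 0 := by
    rw [Filter.EventuallyEq.fderiv_eq (f := fun _ ↦ e A), fderiv_const_apply]
    filter_upwards [hO'.mem_nhds hu] with y hy using hwX A hy
  have hwYe (A : Fin 2) {u : E} (hu : u ∈ O') :
      fderiv ℂ (fun y ↦ fderiv ℂ w y (Y A y)) u = 0 := by
    rw [Filter.EventuallyEq.fderiv_eq (f := fun _ ↦ (0 : E)), fderiv_const_apply]
    filter_upwards [hO'.mem_nhds hu] with y hy using hwY A hy
  have hwc {u : E} (hu : u ∈ O') : ContDiffAt ℂ ω w u := hw.contDiffAt (hO'.mem_nhds hu)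
  have hXX {u : E} (hu : u ∈ O') : lieBracket ℂ (X 0) (X 1) u = 0 := by
    refine (h u hu).2.2.1 _ (hK₁ O' hO'O hO' _ _ (hXc 0) (hXc 1) (fun y hy ↦ hKX 0 hy)
      (fun y hy ↦ hKX 1 hy) u hu) ?_
    rw [fderiv_lieBracket (hwc hu) (hXd 0 hu) (hXd 1 hu), hwXe 0 hu, hwXe 1 hu]
    simp
  -- The kernel of `dw` is exactly the eigenspace for `-i`, because `dw` is injective on the
  -- complementary one.
  have hminus {u v : E} (hu : u ∈ O') (hv : fderiv ℂ w u v = 0) : K u v = -Complex.I • v := by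
    have hi' : -Complex.I * -Complex.I = -1 := by simp
    have h1 : v = eigenProj K Complex.I u v + eigenProj K (-Complex.I) u v := by
      rw [← id_sub_eigenProj, _root_.sub_apply, ContinuousLinearMap.id_apply, add_sub_cancel]
    have h2 := map_eigenProj hi (hKK u (hO'O hu)) v
    have h3 := map_eigenProj hi' (hKK u (hO'O hu)) v
    have h4 := (h u hu).2.1 _ h3
    have h5 : fderiv ℂ w u (eigenProj K Complex.I u v) = 0 := by
      rw [h1, map_add, h4, add_zero] at hv
      exact hv
    rw [(h u hu).2.2.1 _ h2 h5, zero_add] at h1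
    rwa [← h1] at h3
  have hYY {u : E} (hu : u ∈ O') : K u (lieBracket ℂ (Y 0) (Y 1) u) =
      -Complex.I • lieBracket ℂ (Y 0) (Y 1) u :=
    hK₂ O' hO'O hO' _ _ (hYc 0) (hYc 1) (fun y hy ↦ hKY 0 hy) (fun y hy ↦ hKY 1 hy) u hu
  have hYX {u : E} (hu : u ∈ O') :
      K u (lieBracket ℂ (Y 0) (X 1) u + lieBracket ℂ (X 0) (Y 1) u) =
      -Complex.I • (lieBracket ℂ (Y 0) (X 1) u + lieBracket ℂ (X 0) (Y 1) u) := by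
    refine hminus hu ?_
    rw [map_add, fderiv_lieBracket (hwc hu) (hYd 0 hu) (hXd 1 hu),
      fderiv_lieBracket (hwc hu) (hXd 0 hu) (hYd 1 hu), hwXe 0 hu, hwXe 1 hu, hwYe 0 hu,
      hwYe 1 hu]
    simp
  -- `Y_A + c X_A` is an eigenvector of `I` for `c i`, so the bracket of two such fields is too.
  -- After `[X_0, X_1] = 0` it also lies in `K = -i`. Anticommutation makes a common eigenvector
  -- with nonzero eigenvalues vanish.
  have hpencil {u : E} (hu : u ∈ O') {c : ℂ} (hc : c * c = 1)
      (hIc : EigenInvolutive I (c * Complex.I) O) :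
      lieBracket ℂ (Y 0) (Y 1) u +
        c • (lieBracket ℂ (Y 0) (X 1) u + lieBracket ℂ (X 0) (Y 1) u) = 0 := by
    have h1 := hIc O' hO'O hO' (fun y ↦ Y 0 y + c • X 0 y) (fun y ↦ Y 1 y + c • X 1 y)
      ((hYc 0).add ((hXc 0).const_smul c)) ((hYc 1).add ((hXc 1).const_smul c))
      (fun y hy ↦ by
        simp only [map_add, map_smul, hIX, hIY 0 hy, smul_add, smul_smul]
        rw [mul_comm c Complex.I, mul_assoc Complex.I, hc, mul_one, add_comm])
      (fun y hy ↦ by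
        simp only [map_add, map_smul, hIX, hIY 1 hy, smul_add, smul_smul]
        rw [mul_comm c Complex.I, mul_assoc Complex.I, hc, mul_one, add_comm]) u hu
    rw [lieBracket_pencil (hYd 0 hu) (hXd 0 hu) (hYd 1 hu) (hXd 1 hu), hXX hu, smul_zero,
      add_zero] at h1
    set v := lieBracket ℂ (Y 0) (Y 1) u +
        c • (lieBracket ℂ (Y 0) (X 1) u + lieBracket ℂ (X 0) (Y 1) u) with hv
    have h2 : K u v = -Complex.I • v := by
      rw [hv, map_add, map_smul, hYY hu, hYX hu]; module
    have h3 := hIK u (hO'O hu) v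
    rw [h2, map_smul, h1, map_smul, h2, smul_smul, smul_smul, ← sub_eq_zero, sub_neg_eq_add,
      ← add_smul] at h3
    have h4 : -Complex.I * (c * Complex.I) + c * Complex.I * -Complex.I = 2 * c := by
      linear_combination (-2 * c) * hi
    rw [h4, smul_eq_zero] at h3
    refine h3.resolve_left fun h5 ↦ ?_
    have h6 : c = 0 := by linear_combination h5 / 2
    simp [h6] at hc
  refine ⟨O', fun A ↦ ![Y A, X A], hO'O, hO', hu₀', fun A B ↦ ?_, fun u hu ↦
    ⟨fun A ↦ hKX A hu, fun A ↦ hIX A, ?_, ?_, ?_, hXX hu⟩⟩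
  · fin_cases B
    · exact hYc A
    · exact hXc A
  · rw [Fintype.linearIndependent_iff] at he ⊢
    intro g hg
    rw [Fintype.sum_prod_type] at hg
    simp only [Fin.sum_univ_two, Matrix.cons_val_zero, Matrix.cons_val_one] at hg he
    have key (a b : Fin 2 → ℂ)
        (hab : a 0 • Y 0 u + b 0 • X 0 u + (a 1 • Y 1 u + b 1 • X 1 u) = 0) : ∀ A, b A = 0 := by
      refine he b ?_
      have := congrArg (fderiv ℂ w u) hab
      simpa [hwX _ hu, hwY _ hu] using this
    -- `dw` kills each `Y_A` and sends `X_A` to `e_A`, so the coefficients of the `X_A` vanish. The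
    -- map `-i I` exchanges `X_A` and `Y_A`, which reduces the other coefficients to the same
    -- argument.
    have h1 := key (fun A ↦ g (A, 0)) (fun A ↦ g (A, 1)) hg
    have h2 := key (fun A ↦ g (A, 1)) (fun A ↦ g (A, 0)) (by
      have h3 := congrArg (fun v ↦ -Complex.I • I u v) hg
      simp only [map_add, map_smul, hIX, hIY _ hu, map_zero, smul_zero] at h3
      rw [← h3]
      match_scalars <;> ring_nf <;> simp)
    rintro ⟨A, B⟩
    fin_cases B
    · exact h2 A
    · exact h1 A
  all_goals
    simp only [Matrix.cons_val_zero, Matrix.cons_val_one]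
    have h1 := hpencil hu (c := 1) (by ring) (by rwa [one_mul])
    have h2 := hpencil hu (c := -1) (by ring) (by rwa [neg_one_mul])
    rw [one_smul] at h1
    rw [neg_one_smul, ← sub_eq_add_neg, sub_eq_zero] at h2
    rw [h2, ← two_smul ℂ, smul_eq_zero_iff_right two_ne_zero] at h1
    first | exact h1 | exact h2.trans h1

end LocalTetrad

open Topology VectorField

/-! ### The Lax condition and the commutator equations -/

section Commutators

variable {M : Type*} [TopologicalSpace M] [ChartedSpace C4 M] [IsManifold 𝓘(ℂ, C4) ω M]

/-- `X` is a differentiable vector field at `x`. -/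
abbrev DiffVectorAt (X : VField M) (x : M) : Prop :=
  MDifferentiableAt 𝓘(ℂ, C4) 𝓘(ℂ, C4).tangent (fun x ↦ (X x : TangentBundle 𝓘(ℂ, C4) M)) x

theorem HolVectorOn.diffVectorAt {X : VField M} {U : Set M} (hX : HolVectorOn X U) (hU : IsOpen U)
    {x : M} (hx : x ∈ U) : DiffVectorAt X x :=
  (hX.contMDiffAt (hU.mem_nhds hx)).mdifferentiableAt (by simp)

theorem bracket_pencil {X₀ X₁ Y₀ Y₁ : VField M} {x : M} (hX₀ : DiffVectorAt X₀ x)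
    (hX₁ : DiffVectorAt X₁ x) (hY₀ : DiffVectorAt Y₀ x) (hY₁ : DiffVectorAt Y₁ x)
    (p₀ p₁ q₀ q₁ : ℂ) :
    bracket (p₀ • X₀ + p₁ • X₁) (q₀ • Y₀ + q₁ • Y₁) x =
      (p₀ * q₀) • bracket X₀ Y₀ x + (p₀ * q₁) • bracket X₀ Y₁ x +
        (p₁ * q₀) • bracket X₁ Y₀ x + (p₁ * q₁) • bracket X₁ Y₁ x := by
  have hs {X : VField M} (c : ℂ) (hX : DiffVectorAt X x) : DiffVectorAt (c • X) x :=
    MDifferentiableAt.smul_const_section hX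
  have hY : DiffVectorAt (q₀ • Y₀ + q₁ • Y₁) x := 
    mdifferentiableAt_add_section (hs q₀ hY₀) (hs q₁ hY₁)
  rw [bracket, mlieBracket_add_left (hs p₀ hX₀) (hs p₁ hX₁), mlieBracket_const_smul_left hX₀,
    mlieBracket_const_smul_left hX₁, mlieBracket_add_right (hs q₀ hY₀) (hs q₁ hY₁),
    mlieBracket_add_right (hs q₀ hY₀) (hs q₁ hY₁), mlieBracket_const_smul_right hY₀,
    mlieBracket_const_smul_right hY₁, mlieBracket_const_smul_right hY₀,
    mlieBracket_const_smul_right hY₁]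
  simp only [smul_add, smul_smul]
  abel

omit [IsManifold 𝓘(ℂ, C4) ω M] in
theorem lax_infty (V : TetradField M) (A : Fin 2) : lax V A OnePoint.infty = V A 1 := rfl

omit [IsManifold 𝓘(ℂ, C4) ω M] in
theorem lax_coe (V : TetradField M) (A : Fin 2) (z : ℂ) :
    lax V A (z : OnePoint ℂ) = (1 : ℂ) • V A 0 + (-z) • V A 1 := by
  funext x
  change V A 0 x - z • V A 1 x = (1 : ℂ) • V A 0 x + (-z) • V A 1 x
  module

theorem bracket_lax_coe {V : TetradField M} {x : M} (hV : ∀ A B, DiffVectorAt (V A B) x) (z : ℂ) :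
    bracket (lax V 0 z) (lax V 1 z) x = bracket (V 0 0) (V 1 0) x -
      z • (bracket (V 0 0) (V 1 1) x + bracket (V 0 1) (V 1 0) x) +
      (z * z) • bracket (V 0 1) (V 1 1) x := by
  rw [lax_coe, lax_coe, bracket_pencil (hV _ _) (hV _ _) (hV _ _) (hV _ _)]
  module

/-- The Lax condition at a point in terms of the coefficients of the pencil of brackets. -/
theorem bracket_lax_eq_zero_iff {V : TetradField M} {x : M}
    (hV : ∀ A B, DiffVectorAt (V A B) x) :
    (∀ l, bracket (lax V 0 l) (lax V 1 l) x = 0) ↔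
      bracket (V 0 0) (V 1 0) x = 0 ∧
        bracket (V 0 0) (V 1 1) x + bracket (V 0 1) (V 1 0) x = 0 ∧
        bracket (V 0 1) (V 1 1) x = 0 := by
  constructor
  · intro h
    -- The values `0` and `∞` isolate the constant and the leading coefficient of the quadratic
    -- pencil; `1` then gives the middle one.
    have h0 := h ((0 : ℂ) : OnePoint ℂ)
    have h1 := h ((1 : ℂ) : OnePoint ℂ)
    have h2 : bracket (V 0 1) (V 1 1) x = 0 := h OnePoint.infty
    rw [bracket_lax_coe hV, zero_smul, sub_zero, zero_mul, zero_smul, add_zero] at h0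
    rw [bracket_lax_coe hV, h0, h2, smul_zero, add_zero, zero_sub, one_smul, neg_eq_zero] at h1
    exact ⟨h0, h1, h2⟩
  · rintro ⟨h0, h1, h2⟩ l
    induction l using OnePoint.rec with
    | infty => exact h2
    | coe z => rw [bracket_lax_coe hV, h0, h1, h2, smul_zero, smul_zero, sub_zero, add_zero]

/-- Only `A = 0`, `B = 1` carries information: the equations with `A = B` hold by antisymmetry of
the bracket, and exchanging `A` and `B` changes signs only. -/
theorem laxOn_iff_commutatorEqsOn {V : TetradField M} {U : Set M} (hU : IsOpen U)
    (hV : ∀ A B, HolVectorOn (V A B) U) : LaxOn V U ↔ CommutatorEqsOn V U := by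
  have key (x : M) (hx : x ∈ U) :=
    bracket_lax_eq_zero_iff fun A B ↦ (hV A B).diffVectorAt hU hx
  constructor
  · intro h A B x hx
    obtain ⟨h0, h1, h2⟩ := (key x hx).1 fun l ↦ h l x hx
    have hself (X : VField M) : bracket X X x = 0 := by rw [bracket, mlieBracket_self]; rfl
    have hswap (X Y : VField M) : bracket X Y x = -bracket Y X x := mlieBracket_swap_apply
    fin_cases A <;> fin_cases B
    · exact ⟨hself _, by rw [hswap]; exact neg_add_cancel _, hself _⟩
    · exact ⟨h0, h1, h2⟩
    · refine ⟨?_, ?_, ?_⟩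
      · rw [hswap]; exact neg_eq_zero.2 h0
      · refine (congrArg₂ (· + ·) (hswap (V 1 0) (V 0 1)) (hswap (V 1 1) (V 0 0))).trans ?_
        rw [← neg_add, neg_eq_zero, add_comm]
        exact h1
      · rw [hswap]; exact neg_eq_zero.2 h2
    · exact ⟨hself _, by rw [hswap]; exact neg_add_cancel _, hself _⟩
  · intro h l x hx
    exact (key x hx).2 (h 0 1 x hx) l

/-- The bracket of constant combinations of the fields of a tetrad. -/
theorem CommutatorEqsOn.bracket_pencil {V : TetradField M} {U : Set M} (h : CommutatorEqsOn V U)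
    (hU : IsOpen U) (hV : ∀ A B, HolVectorOn (V A B) U) {x : M} (hx : x ∈ U) (A B : Fin 2)
    (p q : Fin 2 → ℂ) :
    bracket (p 0 • V A 0 + p 1 • V A 1) (q 0 • V B 0 + q 1 • V B 1) x =
      (p 0 * q 1 - p 1 * q 0) • bracket (V A 0) (V B 1) x := by
  have hd (A B : Fin 2) := (hV A B).diffVectorAt hU hx
  obtain ⟨h0, h1, h2⟩ := h A B x hx
  rw [HyperHermitian.bracket_pencil (hd _ _) (hd _ _) (hd _ _) (hd _ _), h0, h2,
    eq_neg_of_add_eq_zero_right h1]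
  module

end Commutators

/-! ### Tensoriality of the Nijenhuis expression -/

section Nijenhuis

variable {M : Type*} [TopologicalSpace M] [ChartedSpace C4 M] [IsManifold 𝓘(ℂ, C4) ω M]

theorem HolEnd.diffVectorAt_act {T : EndField M} (hT : HolEnd T) {X : VField M} {x : M}
    (hX : DiffVectorAt X x) : DiffVectorAt (T.act X) x :=
  ((hT x).mdifferentiableAt (by simp)).clm_bundle_apply hX

omit [IsManifold 𝓘(ℂ, C4) ω M] in
theorem nijenhuis_swap (T : EndField M) (X Y : VField M) (x : M) :
    nijenhuis T X Y x = -nijenhuis T Y X x := by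
  have hswap (X Y : VField M) : bracket X Y x = -bracket Y X x := mlieBracket_swap_apply
  simp only [nijenhuis]
  rw [hswap X Y, hswap (T.act X) Y, hswap X (T.act Y), hswap (T.act X) (T.act Y)]
  simp only [map_neg]
  abel

/-- When `X` is multiplied by `f`, the derivatives of `f` along `Y` cancel between the first two
terms and those along `T Y` between the last two. -/
theorem tensorialAt_nijenhuis {T : EndField M} (hT : HolEnd T) (hTT : ∀ x v, T x (T x v) = -v)
    (Y : VField M) (x : M) :
    TensorialAt 𝓘(ℂ, C4) C4 (fun X : VField M ↦ nijenhuis T X Y x) x where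
  smul := by
    intro f X hf hX
    have h1 : T.act (f • X) = f • T.act X := by
      funext y; exact (T y).map_smul (f y) (X y)
    simp only [nijenhuis]
    rw [h1, bracket, bracket, bracket, bracket, mlieBracket_smul_left hf hX,
      mlieBracket_smul_left hf (hT.diffVectorAt_act hX), mlieBracket_smul_left hf hX,
      mlieBracket_smul_left hf (hT.diffVectorAt_act hX)]
    simp only [map_add, map_smul, hTT, EndField.act, smul_sub, smul_add, smul_neg]
    abel
  add := by
    intro X X' hX hX'
    have h1 : T.act (X + X') = T.act X + T.act X' := by
      funext y; exact (T y).map_add (X y) (X' y)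
    simp only [nijenhuis]
    rw [h1, bracket, bracket, bracket, bracket, mlieBracket_add_left hX hX',
      mlieBracket_add_left (hT.diffVectorAt_act hX) (hT.diffVectorAt_act hX'),
      mlieBracket_add_left hX hX',
      mlieBracket_add_left (hT.diffVectorAt_act hX) (hT.diffVectorAt_act hX')]
    simp only [map_add]
    abel

theorem tensorialAt_nijenhuis_right {T : EndField M} (hT : HolEnd T)
    (hTT : ∀ x v, T x (T x v) = -v) (X : VField M) (x : M) :
    TensorialAt 𝓘(ℂ, C4) C4 (fun Y : VField M ↦ nijenhuis T X Y x) x where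
  smul := by
    intro f Y hf hY
    simp only [nijenhuis_swap T X]
    rw [(tensorialAt_nijenhuis hT hTT X x).smul hf hY, smul_neg]
  add := by
    intro Y Y' hY hY'
    simp only [nijenhuis_swap T X]
    rw [(tensorialAt_nijenhuis hT hTT X x).add hY hY', neg_add]

/-- An almost complex structure is integrable if its Nijenhuis tensor vanishes on a frame. -/
theorem integrable_of_frame {ι : Type*} [Fintype ι] {T : EndField M} (hT : HolEnd T)
    (hTT : ∀ x v, T x (T x v) = -v) (W : ι → VField M) (hW : ∀ i x, DiffVectorAt (W i) x)
    (hspan : ∀ x (v : TangentSpace 𝓘(ℂ, C4) x), ∃ c : ι → ℂ, v = ∑ i, c i • W i x)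
    (hN : ∀ i j x, nijenhuis T (W i) (W j) x = 0) : Integrable T := by
  -- A tensorial functional depends only on the value at `x`, so a field may be replaced by a
  -- combination of the frame with constant coefficients.
  have key (Φ : VField M → C4) (x : M) (hΦ : TensorialAt 𝓘(ℂ, C4) C4 Φ x)
      (h : ∀ i, Φ (W i) = 0) (X : VField M) (hX : DiffVectorAt X x) : Φ X = 0 := by
    obtain ⟨c, hc⟩ := hspan x (X x)
    have hs (i : ι) : DiffVectorAt (c i • W i) x := 
      MDifferentiableAt.smul_const_section (hW i x)
    have hsum : DiffVectorAt (fun y ↦ ∑ i, (c i • W i) y) x :=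
      MDifferentiableAt.sum_section fun i _ ↦ hs i
    rw [hΦ.pointwise hX hsum hc, hΦ.sum (fun i ↦ c i • W i) fun i _ ↦ hs i]
    refine Finset.sum_eq_zero fun i _ ↦ ?_
    have := hΦ.smul (f := fun _ ↦ c i) mdifferentiableAt_const (hW i x)
    exact this.trans (by rw [h, smul_zero])
  intro U hU X Y hX hY x hx
  refine key (fun X ↦ nijenhuis T X Y x) x
    (tensorialAt_nijenhuis hT hTT Y x) (fun i ↦ ?_) X (hX.diffVectorAt hU hx)
  exact key (fun Y ↦ nijenhuis T (W i) Y x) x (tensorialAt_nijenhuis_right hT hTT (W i) x)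
    (fun j ↦ hN i j x) Y (hY.diffVectorAt hU hx)

end Nijenhuis

/-! ### Linear algebra of tetrad coefficients -/

open Topology VectorField

/-- Coefficients with respect to a tetrad. -/
abbrev Coef : Type := Fin 2 × Fin 2 → ℂ

section LinearFrame

variable {T : Type*} [AddCommGroup T] [Module ℂ T] [TopologicalSpace T] [IsTopologicalAddGroup T]
  [ContinuousSMul ℂ T]

/-- The linear map that sends coefficients to the corresponding combination of four vectors. -/
def combination (v : Fin 2 × Fin 2 → T) : Coef →L[ℂ] T :=
  ∑ p, (ContinuousLinearMap.proj p : Coef →L[ℂ] ℂ).smulRight (v p)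

theorem combination_apply (v : Fin 2 × Fin 2 → T) (c : Coef) :
    combination v c = ∑ p, c p • v p := by
  simp [combination]

theorem combination_single (v : Fin 2 × Fin 2 → T) (p : Fin 2 × Fin 2) :
    combination v (Pi.single p 1) = v p := by
  rw [combination_apply, Finset.sum_eq_single p] <;> simp +contextual

set_option synthInstance.maxHeartbeats 200000 in
/-- The bilinear form with null tetrad given by the coefficient map `S`. -/
def nullForm (S : T →L[ℂ] Coef) : T →L[ℂ] T →L[ℂ] ℂ :=
  let θ (p : Fin 2 × Fin 2) : T →L[ℂ] ℂ := (ContinuousLinearMap.proj p : Coef →L[ℂ] ℂ) ∘L S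
  (θ (0, 0)).smulRight (θ (1, 1)) + (θ (1, 1)).smulRight (θ (0, 0)) +
    ((-θ (0, 1)).smulRight (θ (1, 0)) + (-θ (1, 0)).smulRight (θ (0, 1)))

omit [IsTopologicalAddGroup T] [ContinuousSMul ℂ T] in
theorem nullForm_apply (S : T →L[ℂ] Coef) (v w : T) : nullForm S v w =
    S v (0, 0) * S w (1, 1) + S v (1, 1) * S w (0, 0) - S v (0, 1) * S w (1, 0) -
      S v (1, 0) * S w (0, 1) := by
  simp only [nullForm, add_apply, ContinuousLinearMap.smulRight_apply,
    smul_apply, neg_apply, ContinuousLinearMap.comp_apply,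
    ContinuousLinearMap.proj_apply, smul_eq_mul]
  ring

theorem contDiff_combination {E : Type*} [NormedAddCommGroup E] [NormedSpace ℂ E] :
    ContDiff ℂ ω (combination : (Fin 2 × Fin 2 → E) → Coef →L[ℂ] E) := by
  refine ContDiff.sum fun p _ ↦ ?_
  exact (ContinuousLinearMap.smulRightL ℂ Coef E (ContinuousLinearMap.proj p)).contDiff.comp
    (contDiff_apply ℂ E p)

theorem contDiff_smulRight {E F : Type*} [NormedAddCommGroup E] [NormedSpace ℂ E]
    [NormedAddCommGroup F] [NormedSpace ℂ F] :
    ContDiff ℂ ω fun q : (E →L[ℂ] ℂ) × F ↦ q.1.smulRight q.2 :=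
  ((ContinuousLinearMap.smulRightL ℂ E F).contDiff.comp contDiff_fst).clm_apply contDiff_snd

set_option synthInstance.maxHeartbeats 200000 in
theorem contDiff_nullForm {E : Type*} [NormedAddCommGroup E] [NormedSpace ℂ E] :
    ContDiff ℂ ω (nullForm : (E →L[ℂ] Coef) → E →L[ℂ] E →L[ℂ] ℂ) := by
  have hθ (p : Fin 2 × Fin 2) : ContDiff ℂ ω fun S : E →L[ℂ] Coef ↦
      (ContinuousLinearMap.proj p : Coef →L[ℂ] ℂ) ∘L S := contDiff_const.clm_comp contDiff_id
  have h (p q : Fin 2 × Fin 2) := contDiff_smulRight.comp ((hθ p).prodMk (hθ q))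
  have h' (p q : Fin 2 × Fin 2) := contDiff_smulRight.comp ((hθ p).neg.prodMk (hθ q))
  exact ((h (0, 0) (1, 1)).add (h (1, 1) (0, 0))).add
    ((h' (0, 1) (1, 0)).add (h' (1, 0) (0, 1)))

theorem isInvertible_combination {E : Type*} [NormedAddCommGroup E] [NormedSpace ℂ E]
    (hE : Module.finrank ℂ E = 4) {v : Fin 2 × Fin 2 → E} (hv : LinearIndependent ℂ v) :
    (combination v).IsInvertible := by
  have : FiniteDimensional ℂ E := Module.finite_of_finrank_pos (by omega)
  have hinj : Function.Injective (combination v) := by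
    rw [injective_iff_map_eq_zero]
    intro c hc
    rw [combination_apply] at hc
    funext p
    exact Fintype.linearIndependent_iff.1 hv c hc p
  have hdim : Module.finrank ℂ Coef = Module.finrank ℂ E := by simp [hE]
  let e := (LinearEquiv.ofInjectiveOfFinrankEq (combination v : Coef →ₗ[ℂ] E) hinj
    hdim).toContinuousLinearEquiv
  exact ⟨e, by ext1; rfl⟩

/-- The action of a `2 × 2` matrix on the primed index of coefficients. -/
def primedAction (m : Matrix (Fin 2) (Fin 2) ℂ) : Coef →L[ℂ] Coef :=
  ContinuousLinearMap.pi fun p ↦ ∑ j, m p.2 j • (ContinuousLinearMap.proj (p.1, j) : Coef →L[ℂ] ℂ)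

theorem primedAction_apply (m : Matrix (Fin 2) (Fin 2) ℂ) (c : Coef) (p : Fin 2 × Fin 2) :
    primedAction m c p = m p.2 0 * c (p.1, 0) + m p.2 1 * c (p.1, 1) := by
  simp [primedAction, Fin.sum_univ_two]

end LinearFrame

/-! ### Holomorphy of tensors built from a frame -/

section FrameTensors

variable {M : Type*} [TopologicalSpace M] [ChartedSpace C4 M]

/-- The map from coefficients to tangent vectors defined by a tetrad. -/
def frameMap (V : TetradField M) (x : M) : Coef →L[ℂ] TangentSpace 𝓘(ℂ, C4) x :=
  combination fun p ↦ V p.1 p.2 x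

/-- The endomorphism field that acts on the primed index of a tetrad by a constant matrix. -/
def frameEnd (V : TetradField M) (m : Matrix (Fin 2) (Fin 2) ℂ) : EndField M := fun x ↦
  frameMap V x ∘L primedAction m ∘L (frameMap V x).inverse

/-- The metric with a given null tetrad. -/
def frameMetric (V : TetradField M) : BilinField M := fun x ↦ nullForm (frameMap V x).inverse

variable [IsManifold 𝓘(ℂ, C4) ω M]

omit [IsManifold 𝓘(ℂ, C4) ω M] in
theorem isInvertible_frameMap {V : TetradField M} {x : M}
    (hV : LinearIndependent ℂ fun p : Fin 2 × Fin 2 ↦ V p.1 p.2 x) :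
    (frameMap V x).IsInvertible :=
  isInvertible_combination (E := C4) (by simp) hV

/-- In a trivialization the frame becomes an analytic operator-valued function `B` with invertible
values. Tensors with constant coefficients in the frame are then expressions in `B` and its inverse,
and inversion of operators is analytic. -/
theorem exists_coordinate_frame {V : TetradField M} (hV : IsHolFrameOn V Set.univ) (x₀ : M) :
    ∃ B : M → Coef →L[ℂ] C4, ContMDiffAt 𝓘(ℂ, C4) 𝓘(ℂ, Coef →L[ℂ] C4) ω B x₀ ∧
      (B x₀).IsInvertible ∧ ∀ x ∈ (trivializationAt C4 (TangentSpace 𝓘(ℂ, C4)) x₀).baseSet,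
        (∀ c, (frameMap V x).inverse
          ((trivializationAt C4 (TangentSpace 𝓘(ℂ, C4)) x₀).symmL ℂ x c) = (B x).inverse c) ∧
        ∀ c, (trivializationAt C4 (TangentSpace 𝓘(ℂ, C4)) x₀).continuousLinearMapAt ℂ x
          (frameMap V x c) = B x c := by
  set e := trivializationAt C4 (TangentSpace 𝓘(ℂ, C4)) x₀ with he
  have hx₀ : x₀ ∈ e.baseSet := FiberBundle.mem_baseSet_trivializationAt' x₀
  let col : M → Fin 2 × Fin 2 → C4 := fun x p ↦ (e ⟨x, V p.1 p.2 x⟩).2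
  have hcol : ContMDiffAt 𝓘(ℂ, C4) 𝓘(ℂ, Fin 2 × Fin 2 → C4) ω col x₀ := by
    rw [contMDiffAt_pi_space]
    intro p
    have := (hV.hol p.1 p.2).contMDiffAt (x := x₀) Filter.univ_mem
    exact (Bundle.contMDiffAt_totalSpace.1 this).2
  have hB (x : M) (hx : x ∈ e.baseSet) (c : Coef) :
      e.continuousLinearMapAt ℂ x (frameMap V x c) = combination (col x) c := by
    rw [frameMap, combination_apply, combination_apply, map_sum]
    refine Finset.sum_congr rfl fun p _ ↦ ?_
    rw [map_smul, Bundle.Trivialization.continuousLinearMapAt_apply,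
      Bundle.Trivialization.coe_linearMapAt_of_mem _ hx]
  have hinv (x : M) (hx : x ∈ e.baseSet) : (combination (col x)).IsInvertible := by
    have h1 : combination (col x) =
        (e.continuousLinearEquivAt ℂ x hx : _ →L[ℂ] C4) ∘L frameMap V x := by
      ext1 c
      rw [← hB x hx c, ContinuousLinearMap.comp_apply, ContinuousLinearEquiv.coe_coe]
      exact (congrFun (e.coe_continuousLinearEquivAt_eq (R := ℂ) hx) _).symm
    rw [h1]
    exact ContinuousLinearMap.IsInvertible.comp ⟨_, rfl⟩
      (isInvertible_frameMap (hV.indep x (Set.mem_univ _)))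
  refine ⟨fun x ↦ combination (col x), contDiff_combination.contDiffAt.comp_contMDiffAt hcol,
    hinv x₀ hx₀, fun x hx ↦ ⟨fun c ↦ ?_, hB x hx⟩⟩
  rw [(isInvertible_frameMap (hV.indep x (Set.mem_univ _))).inverse_apply_eq]
  have h2 : c = e.continuousLinearMapAt ℂ x (frameMap V x ((combination (col x)).inverse c)) := by
    rw [hB x hx]
    exact (hinv x hx).inverse_apply_eq.1 rfl
  conv_lhs => rw [h2]
  exact e.symmL_continuousLinearMapAt (R := ℂ) hx _

theorem holEnd_frameEnd {V : TetradField M} (hV : IsHolFrameOn V Set.univ)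
    (m : Matrix (Fin 2) (Fin 2) ℂ) : HolEnd (frameEnd V m) := by
  intro x₀
  obtain ⟨B, hB, hB₀, h⟩ := exists_coordinate_frame hV x₀
  rw [contMDiffAt_hom_bundle]
  refine ⟨contMDiffAt_id, ?_⟩
  have hinv : ContMDiffAt 𝓘(ℂ, C4) 𝓘(ℂ, C4 →L[ℂ] Coef) ω (fun x ↦ (B x).inverse) x₀ :=
    hB₀.contDiffAt_map_inverse.comp_contMDiffAt hB
  have hcomp : ContMDiffAt 𝓘(ℂ, C4) 𝓘(ℂ, C4 →L[ℂ] C4) ω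
      (fun x ↦ B x ∘L primedAction m ∘L (B x).inverse) x₀ :=
    hB.clm_comp (contMDiffAt_const.clm_comp hinv)
  refine hcomp.congr_of_eventuallyEq ?_
  set e := trivializationAt C4 (TangentSpace 𝓘(ℂ, C4)) x₀ with he
  have hx₀ : x₀ ∈ e.baseSet := FiberBundle.mem_baseSet_trivializationAt' x₀
  filter_upwards [e.open_baseSet.mem_nhds hx₀] with x hx
  ext1 c
  rw [ContinuousLinearMap.inCoordinates_eq hx hx, ContinuousLinearMap.comp_apply,
    ContinuousLinearMap.comp_apply, ContinuousLinearMap.comp_apply, ContinuousLinearMap.comp_apply,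
    ← (h x hx).1, ← (h x hx).2, ContinuousLinearEquiv.coe_coe, ContinuousLinearEquiv.coe_coe,
    e.symm_continuousLinearEquivAt_eq (R := ℂ) hx]
  exact congrFun (e.coe_continuousLinearEquivAt_eq (R := ℂ) hx)
    (frameEnd V m x (e.symmL ℂ x c))

theorem holBilin_frameMetric {V : TetradField M} (hV : IsHolFrameOn V Set.univ) :
    HolBilin (frameMetric V) := by
  intro x₀
  obtain ⟨B, hB, hB₀, h⟩ := exists_coordinate_frame hV x₀
  rw [contMDiffAt_hom_bundle]
  refine ⟨contMDiffAt_id, ?_⟩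
  have hinv : ContMDiffAt 𝓘(ℂ, C4) 𝓘(ℂ, C4 →L[ℂ] Coef) ω (fun x ↦ (B x).inverse) x₀ :=
    hB₀.contDiffAt_map_inverse.comp_contMDiffAt hB
  have hcomp : ContMDiffAt 𝓘(ℂ, C4) 𝓘(ℂ, C4 →L[ℂ] C4 →L[ℂ] ℂ) ω
      (fun x ↦ nullForm (B x).inverse) x₀ :=
    contDiff_nullForm.contDiffAt.comp_contMDiffAt hinv
  refine hcomp.congr_of_eventuallyEq ?_
  set e := trivializationAt C4 (TangentSpace 𝓘(ℂ, C4)) x₀ with he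
  have hx₀ : x₀ ∈ e.baseSet := FiberBundle.mem_baseSet_trivializationAt' x₀
  filter_upwards [e.open_baseSet.mem_nhds hx₀] with x hx
  refine ContinuousLinearMap.ext fun v ↦ ContinuousLinearMap.ext fun w ↦ ?_
  have h1 : ContinuousLinearMap.inCoordinates C4 (TangentSpace 𝓘(ℂ, C4) (M := M)) (C4 →L[ℂ] ℂ)
      (fun x : M ↦ TangentSpace 𝓘(ℂ, C4) x →L[ℂ] ℂ) x₀ x x₀ x (frameMetric V x) v w =
      frameMetric V x (e.symm x v) (e.symm x w) := by
    refine (inCoordinates_apply_eq₂ (𝕜 := ℂ) (F₁ := C4) (F₂ := C4) (F₃ := ℂ)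
      (E₁ := fun x : M ↦ TangentSpace 𝓘(ℂ, C4) x) (E₂ := fun x : M ↦ TangentSpace 𝓘(ℂ, C4) x)
      (E₃ := fun _ ↦ ℂ) hx hx (Set.mem_univ x)).trans ?_
    simp
    rfl
  refine h1.trans ((nullForm_apply _ _ _).trans ?_)
  have h2 (v : C4) : (frameMap V x).inverse (e.symm x v) = (B x).inverse v := by
    rw [← (h x hx).1, e.symmL_apply (R := ℂ) hx]
  rw [h2, h2, nullForm_apply]

end FrameTensors

open Topology VectorField

/-! ### Eigenvectors and the stereographic coordinate -/

section Adapted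

/-- The eigenvector equation for the pencil determined by a quaternionic triple acting on a pair of
vectors. -/
theorem quaternionic_pencil_eigen {T : Type*} [AddCommGroup T] [Module ℂ T] {I J K : T →ₗ[ℂ] T}
    {v₀ v₁ : T} (hI₀ : I v₀ = Complex.I • v₁) (hI₁ : I v₁ = Complex.I • v₀) (hJ₀ : J v₀ = -v₁)
    (hJ₁ : J v₁ = v₀) (hK₀ : K v₀ = -(Complex.I • v₀)) (hK₁ : K v₁ = Complex.I • v₁)
    {a b c p q : ℂ} (h₀ : (Complex.I * a + b) * q - Complex.I * c * p = Complex.I * p)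
    (h₁ : (Complex.I * a - b) * p + Complex.I * c * q = Complex.I * q) :
    a • I (p • v₀ + q • v₁) + b • J (p • v₀ + q • v₁) + c • K (p • v₀ + q • v₁) =
      Complex.I • (p • v₀ + q • v₁) := by
  simp only [map_add, map_smul, hI₀, hI₁, hJ₀, hJ₁, hK₀, hK₁]
  linear_combination (norm := module) h₀ • v₀ + h₁ • v₁

/-- These are the eigenvector equations for the coefficients `(1, -λ)`. After clearing `c - 1`, the
first is the equation of the sphere and the second is the definition of `λ`. -/
theorem stereo_eigen_equations {a b c : ℝ} (h : a ^ 2 + b ^ 2 + c ^ 2 = 1) (hc : c ≠ 1) :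
    (Complex.I * a + b) * -((a + Complex.I * b) / (c - 1) : ℂ) - Complex.I * c * 1 =
        Complex.I * 1 ∧
      (Complex.I * a - b) * 1 + Complex.I * c * -((a + Complex.I * b) / (c - 1) : ℂ) =
        Complex.I * -((a + Complex.I * b) / (c - 1) : ℂ) := by
  have hc' : (c - 1 : ℂ) ≠ 0 := sub_ne_zero.2 (by exact_mod_cast hc)
  have h' : (a ^ 2 + b ^ 2 + c ^ 2 : ℂ) = 1 := by exact_mod_cast h
  constructor
  · field_simp
    linear_combination (-Complex.I) * h' - a * b * Complex.I_sq
  · field_simp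
    linear_combination (1 - c) * b * Complex.I_sq

variable {M : Type*} [TopologicalSpace M] [ChartedSpace C4 M]

/-- A tetrad on which a quaternionic triple acts in the standard way is adapted to the triple. -/
theorem combo_lax_stereo {I J K : EndField M} {V : TetradField M} {x : M}
    (hI₀ : ∀ A, I x (V A 0 x) = Complex.I • V A 1 x)
    (hI₁ : ∀ A, I x (V A 1 x) = Complex.I • V A 0 x)
    (hJ₀ : ∀ A, J x (V A 0 x) = -V A 1 x) (hJ₁ : ∀ A, J x (V A 1 x) = V A 0 x)
    (hK₀ : ∀ A, K x (V A 0 x) = -(Complex.I • V A 0 x))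
    (hK₁ : ∀ A, K x (V A 1 x) = Complex.I • V A 1 x) {a b c : ℝ}
    (h : a ^ 2 + b ^ 2 + c ^ 2 = 1) (A : Fin 2) :
    combo I J K a b c x (lax V A (stereo a b c) x) = Complex.I • lax V A (stereo a b c) x := by
  have key {p q : ℂ} := quaternionic_pencil_eigen (T := TangentSpace 𝓘(ℂ, C4) x)
    (I := (I x).toLinearMap) (J := (J x).toLinearMap) (K := (K x).toLinearMap) (hI₀ A) (hI₁ A) (hJ₀ A) (hJ₁ A) (hK₀ A)
    (hK₁ A) (a := a) (b := b) (c := c) (p := p) (q := q)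
  by_cases hc : c = 1
  · subst hc
    have ha : a = 0 := by nlinarith [sq_nonneg a, sq_nonneg b]
    have hb : b = 0 := by nlinarith [sq_nonneg a, sq_nonneg b]
    subst ha hb
    have := key (p := 0) (q := 1) (by simp) (by simp)
    rw [zero_smul, zero_add, one_smul] at this
    rw [stereo, if_pos rfl, lax_infty]
    exact this
  · obtain ⟨h₀, h₁⟩ := stereo_eigen_equations h hc
    rw [stereo, if_neg hc, lax_coe]
    exact key h₀ h₁

end Adapted

/-! ### Algebra of the metric and endomorphisms of a tetrad -/

section FrameStructure

variable {M : Type*} [TopologicalSpace M] [ChartedSpace C4 M] {V : TetradField M}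

theorem frameMap_single (x : M) (p : Fin 2 × Fin 2) :
    frameMap V x (Pi.single p 1) = V p.1 p.2 x :=
  combination_single _ p

variable (hV : ∀ x, LinearIndependent ℂ fun p : Fin 2 × Fin 2 ↦ V p.1 p.2 x)

include hV

theorem inverse_frameMap_frameMap (x : M) (c : Coef) :
    (frameMap V x).inverse (frameMap V x c) = c :=
  (isInvertible_frameMap (hV x)).inverse_apply_eq.2 rfl

theorem exists_eq_frameMap (x : M) (v : TangentSpace 𝓘(ℂ, C4) x) : ∃ c, v = frameMap V x c :=
  ⟨_, (isInvertible_frameMap (hV x)).inverse_apply_eq.1 rfl⟩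

theorem frameEnd_frameMap (m : Matrix (Fin 2) (Fin 2) ℂ) (x : M) (c : Coef) :
    frameEnd V m x (frameMap V x c) = frameMap V x (primedAction m c) := by
  change frameMap V x (primedAction m ((frameMap V x).inverse (frameMap V x c))) = _
  rw [inverse_frameMap_frameMap hV]

theorem frameEnd_apply (m : Matrix (Fin 2) (Fin 2) ℂ) (x : M) (A j : Fin 2) :
    frameEnd V m x (V A j x) = m 0 j • V A 0 x + m 1 j • V A 1 x := by
  rw [← frameMap_single (V := V) x (A, j), frameEnd_frameMap hV,
    ← frameMap_single (V := V) x (A, 0), ← frameMap_single (V := V) x (A, 1), ← map_smul,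
    ← map_smul, ← map_add]
  congr 1
  funext ⟨B, k⟩
  fin_cases A <;> fin_cases j <;> fin_cases B <;> fin_cases k <;>
    simp [primedAction_apply]

theorem frameEnd_frameEnd (m n : Matrix (Fin 2) (Fin 2) ℂ) (x : M) (v : TangentSpace 𝓘(ℂ, C4) x) :
    frameEnd V m x (frameEnd V n x v) = frameEnd V (m * n) x v := by
  obtain ⟨c, rfl⟩ := exists_eq_frameMap hV x v
  rw [frameEnd_frameMap hV, frameEnd_frameMap hV, frameEnd_frameMap hV]
  congr 1
  funext p
  simp only [primedAction_apply, Matrix.mul_apply, Fin.sum_univ_two]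
  ring

theorem frameEnd_neg_one (x : M) (v : TangentSpace 𝓘(ℂ, C4) x) : frameEnd V (-1) x v = -v := by
  obtain ⟨c, rfl⟩ := exists_eq_frameMap hV x v
  rw [frameEnd_frameMap hV, ← map_neg]
  congr 1
  funext ⟨A, j⟩
  fin_cases j <;> simp [primedAction_apply]

theorem frameEnd_neg (m : Matrix (Fin 2) (Fin 2) ℂ) (x : M) (v : TangentSpace 𝓘(ℂ, C4) x) :
    frameEnd V (-m) x v = -frameEnd V m x v := by
  rw [← frameEnd_neg_one hV, frameEnd_frameEnd hV, neg_one_mul]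

theorem combo_frameEnd (l m n : Matrix (Fin 2) (Fin 2) ℂ) (a b c : ℝ) :
    combo (frameEnd V l) (frameEnd V m) (frameEnd V n) a b c =
      frameEnd V ((a : ℂ) • l + (b : ℂ) • m + (c : ℂ) • n) := by
  funext x
  ext1 v
  obtain ⟨d, rfl⟩ := exists_eq_frameMap hV x v
  change (a : ℂ) • frameEnd V l x _ + (b : ℂ) • frameEnd V m x _ + (c : ℂ) • frameEnd V n x _ = _
  simp only [frameEnd_frameMap hV, ← map_smul, ← map_add]
  congr 1
  funext p
  simp only [primedAction_apply, Pi.add_apply, Pi.smul_apply, Matrix.add_apply, Matrix.smul_apply,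
    smul_eq_mul]
  ring

theorem frameMetric_frameMap (x : M) (c d : Coef) :
    frameMetric V x (frameMap V x c) (frameMap V x d) =
      c (0, 0) * d (1, 1) + c (1, 1) * d (0, 0) - c (0, 1) * d (1, 0) - c (1, 0) * d (0, 1) := by
  refine (nullForm_apply _ _ _).trans ?_
  rw [inverse_frameMap_frameMap hV, inverse_frameMap_frameMap hV]

/-- The metric is the product of an area form on the unprimed index and one on the primed index; `m`
acts on the latter alone and scales it by its determinant. -/
theorem frameMetric_frameEnd (m : Matrix (Fin 2) (Fin 2) ℂ) (x : M)
    (v w : TangentSpace 𝓘(ℂ, C4) x) :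
    frameMetric V x (frameEnd V m x v) (frameEnd V m x w) = m.det * frameMetric V x v w := by
  obtain ⟨c, rfl⟩ := exists_eq_frameMap hV x v
  obtain ⟨d, rfl⟩ := exists_eq_frameMap hV x w
  rw [frameEnd_frameMap hV, frameEnd_frameMap hV, frameMetric_frameMap hV,
    frameMetric_frameMap hV, Matrix.det_fin_two]
  simp only [primedAction_apply]
  ring

theorem frameMetric_tetrad (x : M) (A A' B B' : Fin 2) :
    frameMetric V x (V A A' x) (V B B' x) = eps A B * eps A' B' := by
  rw [← frameMap_single (V := V) x (A, A'), ← frameMap_single (V := V) x (B, B'),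
    frameMetric_frameMap hV]
  fin_cases A <;> fin_cases A' <;> fin_cases B <;> fin_cases B' <;>
    simp [eps]

end FrameStructure

/-! ### The hyper-Hermitian structure of a tetrad -/

section FrameHyperHermitian

variable {M : Type*} [TopologicalSpace M] [ChartedSpace C4 M] [IsManifold 𝓘(ℂ, C4) ω M]
  {V : TetradField M}

theorem isHolMetric_frameMetric (hV : IsHolFrameOn V Set.univ) :
    IsHolMetric (frameMetric V) where
  hol := holBilin_frameMetric hV
  symm x v w := by
    have hi (x : M) := hV.indep x (Set.mem_univ x)
    obtain ⟨c, rfl⟩ := exists_eq_frameMap hi x v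
    obtain ⟨d, rfl⟩ := exists_eq_frameMap hi x w
    rw [frameMetric_frameMap hi, frameMetric_frameMap hi]
    ring
  nondegenerate x v h := by
    have hi (x : M) := hV.indep x (Set.mem_univ x)
    obtain ⟨c, rfl⟩ := exists_eq_frameMap hi x v
    have h' (d : Coef) := (frameMetric_frameMap hi x c d).symm.trans (h _)
    have hc : c = 0 := by
      funext ⟨A, j⟩
      -- Each tetrad vector pairs, up to sign, with the one having both indices flipped, so this
      -- test vector isolates `c (A, j)`.
      have h1 := h' (Pi.single (1 - A, 1 - j) 1)
      fin_cases A <;> fin_cases j <;> simpa [Pi.single_apply] using h1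
    rw [hc, map_zero]

/-- Constant traceless structures of unit determinant on a tetrad that satisfies the commutator
equations are integrable. -/
theorem integrable_frameEnd (hV : IsHolFrameOn V Set.univ) (h : CommutatorEqsOn V Set.univ)
    {m : Matrix (Fin 2) (Fin 2) ℂ} (hm : m * m = -1) (htr : m 0 0 + m 1 1 = 0) (hdet : m.det = 1) :
    Integrable (frameEnd V m) := by
  have hi (x : M) := hV.indep x (Set.mem_univ x)
  have hTT (x : M) (v : TangentSpace 𝓘(ℂ, C4) x) :
      frameEnd V m x (frameEnd V m x v) = -v := by
    rw [frameEnd_frameEnd hi, hm, frameEnd_neg_one hi]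
  refine integrable_of_frame (holEnd_frameEnd hV m) hTT (fun p : Fin 2 × Fin 2 ↦ V p.1 p.2)
    (fun p x ↦ (hV.hol _ _).diffVectorAt isOpen_univ (Set.mem_univ x)) (fun x v ↦ ?_) ?_
  · obtain ⟨c, rfl⟩ := exists_eq_frameMap hi x v
    exact ⟨c, combination_apply _ c⟩
  rintro ⟨A, j⟩ ⟨B, l⟩ x
  have hact (A j : Fin 2) : (frameEnd V m).act (V A j) = m 0 j • V A 0 + m 1 j • V A 1 :=
    funext fun x ↦ frameEnd_apply hi m x A j
  have hid (A j : Fin 2) : V A j =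
      (Pi.single j 1 : Fin 2 → ℂ) 0 • V A 0 + (Pi.single j 1 : Fin 2 → ℂ) 1 • V A 1 := by
    fin_cases j <;> simp
  have key := h.bracket_pencil isOpen_univ hV.hol (Set.mem_univ x) A B
  have k1 := key (Pi.single j 1) (Pi.single l 1)
  have k2 := key (fun i ↦ m i j) (Pi.single l 1)
  have k3 := key (Pi.single j 1) (fun i ↦ m i l)
  have k4 := key (fun i ↦ m i j) (fun i ↦ m i l)
  rw [← hid, ← hid] at k1
  rw [← hid, ← hact] at k2
  rw [← hid, ← hact] at k3
  rw [← hact, ← hact] at k4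
  have hdet' := hdet
  rw [Matrix.det_fin_two] at hdet'
  simp only [nijenhuis]
  rw [k1, k2, k3, k4]
  simp only [map_smul, hTT]
  have e1 : m 1 1 = -m 0 0 := by linear_combination htr
  -- All four brackets are multiples of `[∇_{A0'}, ∇_{B1'}]`. Trace zero cancels the two middle
  -- coefficients; determinant one makes the outer two equal, and these cancel because `T² = -1`.
  have h23 : (m 0 j * (Pi.single l 1 : Fin 2 → ℂ) 1 - m 1 j * (Pi.single l 1 : Fin 2 → ℂ) 0) +
      ((Pi.single j 1 : Fin 2 → ℂ) 0 * m 1 l - (Pi.single j 1 : Fin 2 → ℂ) 1 * m 0 l) = 0 := by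
    fin_cases j <;> fin_cases l <;> simp [e1]
  have h14 : m 0 j * m 1 l - m 1 j * m 0 l =
      (Pi.single j 1 : Fin 2 → ℂ) 0 * (Pi.single l 1 : Fin 2 → ℂ) 1 -
        (Pi.single j 1 : Fin 2 → ℂ) 1 * (Pi.single l 1 : Fin 2 → ℂ) 0 := by
    fin_cases j <;> fin_cases l <;> simp <;>
      first | ring1 | linear_combination hdet' | linear_combination -hdet'
  rw [h14, eq_neg_of_add_eq_zero_left h23]
  module

/-- A tetrad that satisfies the commutator equations is a null tetrad of a hyper-Hermitian
structure. -/
theorem exists_isHyperHermitian_isNullTetradOn (hV : IsHolFrameOn V Set.univ)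
    (h : CommutatorEqsOn V Set.univ) : ∃ (g : BilinField M) (I J K : EndField M),
      IsHyperHermitian g I J K ∧ IsNullTetradOn g I J K V Set.univ := by
  have hi (x : M) := hV.indep x (Set.mem_univ x)
  -- Up to sign these are `i` times the Pauli matrices, as prescribed by the eigenvector condition
  -- at opposite points of the three coordinate axes.
  let I := frameEnd V !![0, Complex.I; Complex.I, 0]
  let J := frameEnd V !![0, 1; -1, 0]
  let K := frameEnd V !![-Complex.I, 0; 0, Complex.I]
  have hcombo (a b c : ℝ) : combo I J K a b c =
      frameEnd V !![-(Complex.I * c), Complex.I * a + b; Complex.I * a - b, Complex.I * c] := by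
    rw [combo_frameEnd hi]
    congr 1
    ext i j
    fin_cases i <;> fin_cases j <;> simp <;> ring
  have hdet {a b c : ℝ} (habc : a ^ 2 + b ^ 2 + c ^ 2 = 1) :
      !![-(Complex.I * c), Complex.I * a + b; Complex.I * a - b, Complex.I * c].det = 1 := by
    have h' : (a ^ 2 + b ^ 2 + c ^ 2 : ℂ) = 1 := by exact_mod_cast habc
    rw [Matrix.det_fin_two_of]
    linear_combination h' - (a ^ 2 + c ^ 2) * Complex.I_sq
  refine ⟨frameMetric V, I, J, K, ⟨isHolMetric_frameMetric hV, ?_, ?_⟩, ?_, ?_⟩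
  · have hsq {m : Matrix (Fin 2) (Fin 2) ℂ} (hm : m * m = -1) (x : M)
        (v : TangentSpace 𝓘(ℂ, C4) x) : frameEnd V m x (frameEnd V m x v) = -v := by
      rw [frameEnd_frameEnd hi, hm, frameEnd_neg_one hi]
    refine ⟨holEnd_frameEnd hV _, holEnd_frameEnd hV _, holEnd_frameEnd hV _, hsq ?_, hsq ?_,
      hsq ?_, fun x v ↦ ?_, fun x v ↦ ?_, fun a b c habc ↦ ?_⟩
    · ext i j; fin_cases i <;> fin_cases j <;> simp [Matrix.mul_apply]
    · ext i j; fin_cases i <;> fin_cases j <;> simp [Matrix.mul_apply]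
    · ext i j; fin_cases i <;> fin_cases j <;> simp [Matrix.mul_apply]
    · rw [frameEnd_frameEnd hi]
      congr 2
      ext i j; fin_cases i <;> fin_cases j <;> simp [Matrix.mul_apply]
    · rw [frameEnd_frameEnd hi, ← frameEnd_neg hi]
      congr 2
      ext i j; fin_cases i <;> fin_cases j <;> simp [Matrix.mul_apply]
    · rw [hcombo]
      refine integrable_frameEnd hV h ?_ (by simp) (hdet habc)
      have h' := hdet habc
      rw [Matrix.det_fin_two_of] at h'
      ext i j
      fin_cases i <;> fin_cases j <;> simp [Matrix.mul_apply]
      · linear_combination -h'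
      · ring
      · ring
      · linear_combination -h'
  · intro a b c habc x v w
    rw [hcombo, frameMetric_frameEnd hi, hdet habc, one_mul]
  · exact fun x _ ↦ frameMetric_tetrad hi x
  · intro a b c habc x _ A
    refine combo_lax_stereo ?_ ?_ ?_ ?_ ?_ ?_ habc A <;> intro A <;>
      exact (frameEnd_apply hi _ x A _).trans (by simp)

end FrameHyperHermitian

/-! ### Transport between the manifold and a chart -/

open Topology VectorField

theorem mlieBracket_vectorSpace_eq_lieBracket {E : Type*} [NormedAddCommGroup E] [NormedSpace ℂ E]
    (X Y : (u : E) → TangentSpace 𝓘(ℂ, E) u) :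
    mlieBracket 𝓘(ℂ, E) X Y = lieBracket ℂ X Y := by
  rw [← mlieBracketWithin_univ, mlieBracketWithin_eq_lieBracketWithin]
  exact lieBracketWithin_univ

section Chart

variable {M : Type*} [TopologicalSpace M] [ChartedSpace C4 M]

/-- The derivative at `x` of the chart centred at `p`. -/
def chartDeriv (p x : M) : TangentSpace 𝓘(ℂ, C4) x →L[ℂ] C4 :=
  mfderiv 𝓘(ℂ, C4) 𝓘(ℂ, C4) (extChartAt 𝓘(ℂ, C4) p) x

/-- The pullback to `M` of a vector field in the chart centred at `p`. -/
def chartPullback (p : M) (X : C4 → C4) : VField M := fun x ↦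
  (chartDeriv p x).inverse (X (extChartAt 𝓘(ℂ, C4) p x))

/-- The expression of an endomorphism field in the chart centred at `p`. -/
def chartEnd (p : M) (T : EndField M) (u : C4) : C4 →L[ℂ] C4 :=
  chartDeriv p ((extChartAt 𝓘(ℂ, C4) p).symm u) ∘L T ((extChartAt 𝓘(ℂ, C4) p).symm u) ∘L
    (chartDeriv p ((extChartAt 𝓘(ℂ, C4) p).symm u)).inverse

theorem chartPullback_eq_mpullback (p : M) (X : C4 → C4) : chartPullback p X =
    mpullback 𝓘(ℂ, C4) 𝓘(ℂ, C4) (extChartAt 𝓘(ℂ, C4) p) X := rfl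

variable [IsManifold 𝓘(ℂ, C4) ω M] {p x : M}

theorem isInvertible_chartDeriv (hx : x ∈ (extChartAt 𝓘(ℂ, C4) p).source) :
    (chartDeriv p x).IsInvertible :=
  isInvertible_mfderiv_extChartAt hx

theorem chartDeriv_chartPullback (hx : x ∈ (extChartAt 𝓘(ℂ, C4) p).source) (X : C4 → C4) :
    chartDeriv p x (chartPullback p X x) = X (extChartAt 𝓘(ℂ, C4) p x) :=
  ((isInvertible_chartDeriv hx).inverse_apply_eq.1 rfl).symm

theorem chartDeriv_injective (hx : x ∈ (extChartAt 𝓘(ℂ, C4) p).source) :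
    Function.Injective (chartDeriv p x) :=
  (isInvertible_chartDeriv hx).injective

theorem chartEnd_chartDeriv (hx : x ∈ (extChartAt 𝓘(ℂ, C4) p).source) (T : EndField M)
    (v : TangentSpace 𝓘(ℂ, C4) x) :
    chartEnd p T (extChartAt 𝓘(ℂ, C4) p x) (chartDeriv p x v) = chartDeriv p x (T x v) := by
  rw [chartEnd, (extChartAt 𝓘(ℂ, C4) p).left_inv hx, ContinuousLinearMap.comp_apply,
    ContinuousLinearMap.comp_apply, (isInvertible_chartDeriv hx).inverse_apply_eq.2 rfl]

theorem chartDeriv_bracket (hx : x ∈ (extChartAt 𝓘(ℂ, C4) p).source) {X Y : C4 → C4}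
    (hX : ContDiffAt ℂ ω X (extChartAt 𝓘(ℂ, C4) p x))
    (hY : ContDiffAt ℂ ω Y (extChartAt 𝓘(ℂ, C4) p x)) :
    chartDeriv p x (bracket (chartPullback p X) (chartPullback p Y) x) =
      lieBracket ℂ X Y (extChartAt 𝓘(ℂ, C4) p x) := by
  have h := mpullback_mlieBracket (I := 𝓘(ℂ, C4)) (I' := 𝓘(ℂ, C4)) (n := ω) (x₀ := x)
    (f := extChartAt 𝓘(ℂ, C4) p) (V := X) (W := Y)
    ((contMDiffAt_vectorSpace_iff_contDiffAt.2 hX).mdifferentiableAt (by simp))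
    ((contMDiffAt_vectorSpace_iff_contDiffAt.2 hY).mdifferentiableAt (by simp))
    (contMDiffAt_extChartAt' (by simpa using hx)) (by simp)
  exact (congrArg (chartDeriv p x) h.symm).trans
    ((chartDeriv_chartPullback hx (mlieBracket 𝓘(ℂ, C4) X Y)).trans
      (congrFun (mlieBracket_vectorSpace_eq_lieBracket X Y) _))

theorem holVectorOn_chartPullback {X : C4 → C4} {O : Set C4} (hO : IsOpen O)
    (hX : ContDiffOn ℂ ω X O) : HolVectorOn (chartPullback p X)
      ((extChartAt 𝓘(ℂ, C4) p).source ∩ extChartAt 𝓘(ℂ, C4) p ⁻¹' O) := by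
  rintro x ⟨hx, hxO⟩
  refine ContMDiffAt.contMDiffWithinAt ?_
  rw [chartPullback_eq_mpullback]
  exact ContMDiffAt.mpullback_vectorField_preimage (n := ω)
    (contMDiffAt_vectorSpace_iff_contDiffAt.2 (hX.contDiffAt (hO.mem_nhds hxO)))
    (contMDiffAt_extChartAt' (by simpa using hx)) (isInvertible_mfderiv_extChartAt hx) (by simp)

/-- Over the chart domain, the trivialization of the tangent bundle at `p` is the derivative of the
chart, so the bundle notion of holomorphy is analyticity of the coordinate expression. -/
theorem HolEnd.contDiffAt_chartEnd {T : EndField M} (hT : HolEnd T) (p : M) :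
    ContDiffAt ℂ ω (chartEnd p T) (extChartAt 𝓘(ℂ, C4) p p) := by
  have h1 := (contMDiffAt_hom_bundle _).1 (hT p)
  have h2 : ContMDiffAt 𝓘(ℂ, C4) 𝓘(ℂ, C4) ω (extChartAt 𝓘(ℂ, C4) p).symm
      (extChartAt 𝓘(ℂ, C4) p p) :=
    (contMDiffOn_extChartAt_symm p).contMDiffAt (extChartAt_target_mem_nhds p)
  have h3 := contMDiffAt_iff_contDiffAt.1 (ContMDiffAt.comp_of_eq h1.2 h2 (by simp))
  refine h3.congr_of_eventuallyEq ?_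
  filter_upwards [extChartAt_target_mem_nhds (I := 𝓘(ℂ, C4)) p] with u hu
  have hx := (extChartAt 𝓘(ℂ, C4) p).map_target hu
  have hx' : (extChartAt 𝓘(ℂ, C4) p).symm u ∈ (chartAt C4 p).source := by simpa using hx
  have hb : (extChartAt 𝓘(ℂ, C4) p).symm u ∈
    (trivializationAt C4 (TangentSpace 𝓘(ℂ, C4)) p).baseSet := by simpa using hx
  have hD : (trivializationAt C4 (TangentSpace 𝓘(ℂ, C4)) p).continuousLinearMapAt ℂ
      ((extChartAt 𝓘(ℂ, C4) p).symm u) = chartDeriv p ((extChartAt 𝓘(ℂ, C4) p).symm u) :=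
    TangentBundle.continuousLinearMapAt_trivializationAt hx'
  ext1 c
  change chartDeriv p _ (T _ ((chartDeriv p _).inverse c)) =
    (trivializationAt C4 (TangentSpace 𝓘(ℂ, C4)) p).continuousLinearMapAt ℂ _
      (T _ ((trivializationAt C4 (TangentSpace 𝓘(ℂ, C4)) p).symmL ℂ _ c))
  rw [hD]
  congr 2
  rw [(isInvertible_chartDeriv hx).inverse_apply_eq, ← hD,
    Bundle.Trivialization.continuousLinearMapAt_symmL _ hb]

/-- Eigendistributions of an integrable almost complex structure are involutive. -/
theorem Integrable.eigenInvolutive_chartEnd {T : EndField M} (hT : Integrable T)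
    (hTT : ∀ x v, T x (T x v) = -v) {μ : ℂ} (hμ : μ * μ = -1) (p : M) :
    EigenInvolutive (chartEnd p T) μ (extChartAt 𝓘(ℂ, C4) p).target := by
  intro O hO hOo X Y hX hY hTX hTY u hu
  set φ := extChartAt 𝓘(ℂ, C4) p with hφ
  have hUo : IsOpen (φ.source ∩ φ ⁻¹' O) := isOpen_extChartAt_preimage' p hOo
  have hx : φ.symm u ∈ φ.source ∩ φ ⁻¹' O :=
    ⟨φ.map_target (hO hu), by rw [Set.mem_preimage, φ.right_inv (hO hu)]; exact hu⟩
  obtain ⟨x, hxu⟩ : ∃ x, x = φ.symm u := ⟨_, rfl⟩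
  rw [← hxu] at hx
  have hux : u = φ x := by rw [hxu, φ.right_inv (hO hu)]
  subst hux
  have hact {Z : C4 → C4} (hZ : ∀ u ∈ O, chartEnd p T u (Z u) = μ • Z u) {y : M}
      (hy : y ∈ φ.source ∩ φ ⁻¹' O) :
      T.act (chartPullback p Z) y = (μ • chartPullback p Z) y := by
    refine chartDeriv_injective hy.1 ?_
    refine (chartEnd_chartDeriv hy.1 T _).symm.trans ?_
    rw [Pi.smul_apply, map_smul, chartDeriv_chartPullback hy.1]
    exact hZ _ hy.2
  have hact' {Z : C4 → C4} (hZ : ∀ u ∈ O, chartEnd p T u (Z u) = μ • Z u) :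
      T.act (chartPullback p Z) =ᶠ[𝓝 x] μ • chartPullback p Z := by
    filter_upwards [hUo.mem_nhds hx] with y hy using hact hZ hy
  have hXh := holVectorOn_chartPullback (p := p) hOo hX
  have hYh := holVectorOn_chartPullback (p := p) hOo hY
  have hN := hT _ hUo _ _ hXh hYh x hx
  have hXd := hXh.diffVectorAt hUo hx
  have hYd := hYh.diffVectorAt hUo hx
  simp only [nijenhuis] at hN
  have e1 : bracket (T.act (chartPullback p X)) (chartPullback p Y) x =
      μ • bracket (chartPullback p X) (chartPullback p Y) x :=
    ((hact' hTX).mlieBracket_vectorField_eq Filter.EventuallyEq.rfl).trans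
      (mlieBracket_const_smul_left hXd)
  have e2 : bracket (chartPullback p X) (T.act (chartPullback p Y)) x =
      μ • bracket (chartPullback p X) (chartPullback p Y) x :=
    (Filter.EventuallyEq.mlieBracket_vectorField_eq Filter.EventuallyEq.rfl (hact' hTY)).trans
      (mlieBracket_const_smul_right hYd)
  have e3 : bracket (T.act (chartPullback p X)) (T.act (chartPullback p Y)) x =
      μ • μ • bracket (chartPullback p X) (chartPullback p Y) x :=
    ((hact' hTX).mlieBracket_vectorField_eq (hact' hTY)).trans
      ((mlieBracket_const_smul_left hXd).trans
        (congrArg (μ • ·) (mlieBracket_const_smul_right hYd)))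
  rw [e1, e2, e3, hTT, smul_smul, hμ, map_smul] at hN
  -- On `μ`-eigenfields with bracket `b`, the Nijenhuis equation reads `-2 b - 2 μ T b = 0`, and `μ²
  -- = -1` turns this into `T b = μ b`.
  have hb : T x (bracket (chartPullback p X) (chartPullback p Y) x) =
      μ • bracket (chartPullback p X) (chartPullback p Y) x := by
    linear_combination (norm := module) (μ / 2) • hN +
      hμ • T x (bracket (chartPullback p X) (chartPullback p Y) x)
  have hd {Z : C4 → C4} (hZ : ContDiffOn ℂ ω Z O) : ContDiffAt ℂ ω Z (φ x) :=
    hZ.contDiffAt (hOo.mem_nhds hu)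
  rw [← chartDeriv_bracket hx.1 (hd hX) (hd hY), chartEnd_chartDeriv hx.1, hb, map_smul]

end Chart

open Topology VectorField

/-! ### Null tetrads of a hyper-Hermitian structure -/

section HyperHermitianTetrad

variable {M : Type*} [TopologicalSpace M] [ChartedSpace C4 M] [IsManifold 𝓘(ℂ, C4) ω M]
  {g : BilinField M} {I J K : EndField M}

theorem IsHypercomplex.I_K (h : IsHypercomplex I J K) (x : M) (v : TangentSpace 𝓘(ℂ, C4) x) :
    I x (K x v) = -J x v := by
  rw [← h.I_J, h.I_sq]

theorem IsHypercomplex.I_K_anticomm (h : IsHypercomplex I J K) (x : M)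
    (v : TangentSpace 𝓘(ℂ, C4) x) : I x (K x v) = -K x (I x v) := by
  rw [h.I_K, ← h.I_J x (I x v), h.J_I, map_neg, h.I_K, neg_neg]

omit [IsManifold 𝓘(ℂ, C4) ω M] in
theorem combo_I (I J K : EndField M) : combo I J K 1 0 0 = I := by
  funext x
  simp [combo]

omit [IsManifold 𝓘(ℂ, C4) ω M] in
theorem combo_K (I J K : EndField M) : combo I J K 0 0 1 = K := by
  funext x
  simp [combo]

/-- A hypercomplex structure admits local tetrads that satisfy the commutator equations and consist
of eigenvectors. -/
theorem IsHypercomplex.exists_tetrad (h : IsHypercomplex I J K) (p : M) :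
    ∃ (U : Set M) (V : TetradField M), IsOpen U ∧ p ∈ U ∧ IsHolFrameOn V U ∧ LaxOn V U ∧
      ∀ x ∈ U, ∀ A, K x (V A 1 x) = Complex.I • V A 1 x ∧ I x (V A 1 x) = Complex.I • V A 0 x := by
  set φ := extChartAt 𝓘(ℂ, C4) p with hφ
  -- Integrability of `I` and `K` alone suffices for the tetrad.
  have hI : Integrable I := by
    have := h.integrable 1 0 0 (by norm_num)
    rwa [combo_I] at this
  have hK : Integrable K := by
    have := h.integrable 0 0 1 (by norm_num)
    rwa [combo_K] at this
  have hin {x : M} (hx : x ∈ φ.source) := isInvertible_chartDeriv (p := p) hx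
  have hφx {u : C4} (hu : u ∈ φ.target) (v : C4) : ∃ x ∈ φ.source, u = φ x ∧ ∃ w,
      v = chartDeriv p x w :=
    ⟨φ.symm u, φ.map_target hu, (φ.right_inv hu).symm, _,
      (hin (φ.map_target hu)).inverse_apply_eq.1 rfl⟩
  obtain ⟨O, hOt, hO, hpO, hchartI, hchartK⟩ : ∃ O ⊆ φ.target, IsOpen O ∧ φ p ∈ O ∧
      ContDiffOn ℂ ω (chartEnd p I) O ∧ ContDiffOn ℂ ω (chartEnd p K) O := by
    have hev := ((h.hol_I.contDiffAt_chartEnd p).eventually (by simp)).and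
      ((h.hol_K.contDiffAt_chartEnd p).eventually (by simp))
    obtain ⟨O, hOt, hO, hp, hO'⟩ := exists_isOpen_subset (isOpen_extChartAt_target p)
      (mem_extChartAt_target p) hev
    exact ⟨O, hOt, hO, hp, fun u hu ↦ (hO' u hu).1.contDiffWithinAt,
      fun u hu ↦ (hO' u hu).2.contDiffWithinAt⟩
  have hsq {T : EndField M} (hT : ∀ x v, T x (T x v) = -v) (u : C4) (hu : u ∈ O) (v : C4) :
      chartEnd p T u (chartEnd p T u v) = -v := by
    obtain ⟨x, hx, rfl, w, rfl⟩ := hφx (hOt hu) v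
    rw [chartEnd_chartDeriv hx, chartEnd_chartDeriv hx, hT, map_neg]
  have hIK (u : C4) (hu : u ∈ O) (v : C4) :
      chartEnd p I u (chartEnd p K u v) = -chartEnd p K u (chartEnd p I u v) := by
    obtain ⟨x, hx, rfl, w, rfl⟩ := hφx (hOt hu) v
    rw [chartEnd_chartDeriv hx, chartEnd_chartDeriv hx, chartEnd_chartDeriv hx,
      chartEnd_chartDeriv hx, h.I_K_anticomm, map_neg]
  have hinv {T : EndField M} (hT : Integrable T) (hTT : ∀ x v, T x (T x v) = -v) {μ : ℂ}
      (hμ : μ * μ = -1) : EigenInvolutive (chartEnd p T) μ O := fun O' hO' ↦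
    hT.eigenInvolutive_chartEnd hTT hμ p O' (hO'.trans hOt)
  have hi : Complex.I * Complex.I = -1 := Complex.I_mul_I
  have hi' : -Complex.I * -Complex.I = -1 := by rw [neg_mul_neg, hi]
  obtain ⟨O', V, hO'O, hO', hpO', hV, hVe⟩ := exists_local_tetrad (by simp) hO hpO hchartI hchartK
    (hsq h.I_sq) (hsq h.K_sq) hIK (hinv hK h.K_sq hi) (hinv hK h.K_sq hi') (hinv hI h.I_sq hi)
    (hinv hI h.I_sq hi')
  have hUo : IsOpen (φ.source ∩ φ ⁻¹' O') := isOpen_extChartAt_preimage' p hO'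
  have hhol (A B : Fin 2) : HolVectorOn (chartPullback p (V A B)) (φ.source ∩ φ ⁻¹' O') :=
    holVectorOn_chartPullback hO' (hV A B)
  have hbr {x : M} (hx : x ∈ φ.source ∩ φ ⁻¹' O') (A B A' B' : Fin 2) :
      chartDeriv p x (bracket (chartPullback p (V A B)) (chartPullback p (V A' B')) x) =
        lieBracket ℂ (V A B) (V A' B') (φ x) :=
    chartDeriv_bracket hx.1 ((hV A B).contDiffAt (hO'.mem_nhds hx.2))
      ((hV A' B').contDiffAt (hO'.mem_nhds hx.2))
  refine ⟨φ.source ∩ φ ⁻¹' O', fun A B ↦ chartPullback p (V A B), hUo,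
    ⟨mem_extChartAt_source p, hpO'⟩, ⟨hhol, fun x hx ↦ ?_⟩, fun l x hx ↦ ?_, fun x hx A ↦ ⟨?_, ?_⟩⟩
  · refine LinearIndependent.of_comp (chartDeriv p x).toLinearMap ?_
    have hcomp : (chartDeriv p x ∘ fun q : Fin 2 × Fin 2 ↦ chartPullback p (V q.1 q.2) x) =
        fun q ↦ V q.1 q.2 (φ x) := funext fun q ↦ chartDeriv_chartPullback hx.1 _
    have hlin := (hVe _ hx.2).2.2.1
    rw [← hcomp] at hlin
    exact hlin
  · obtain ⟨-, -, -, h0, h1, h2⟩ := hVe _ hx.2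
    refine (bracket_lax_eq_zero_iff fun A B ↦ (hhol A B).diffVectorAt hUo hx).2 ⟨?_, ?_, ?_⟩ l
    · exact chartDeriv_injective hx.1 (by rw [hbr hx, h0, map_zero])
    · exact chartDeriv_injective hx.1 (by rw [map_add, hbr hx, hbr hx, h1, map_zero])
    · exact chartDeriv_injective hx.1 (by rw [hbr hx, h2, map_zero])
  · refine chartDeriv_injective hx.1 ?_
    rw [← chartEnd_chartDeriv hx.1, map_smul, chartDeriv_chartPullback hx.1]
    exact (hVe _ hx.2).1 A
  · refine chartDeriv_injective hx.1 ?_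
    rw [← chartEnd_chartDeriv hx.1, map_smul, chartDeriv_chartPullback hx.1,
      chartDeriv_chartPullback hx.1]
    exact (hVe _ hx.2).2.1 A

/-- The metric on a tetrad of eigenvectors, up to a factor. -/
theorem IsHyperHermitian.metric_tetrad (h : IsHyperHermitian g I J K) {V : TetradField M} {x : M}
    (hK₀ : ∀ A, K x (V A 0 x) = -(Complex.I • V A 0 x))
    (hK₁ : ∀ A, K x (V A 1 x) = Complex.I • V A 1 x)
    (hI₀ : ∀ A, I x (V A 0 x) = Complex.I • V A 1 x)
    (hI₁ : ∀ A, I x (V A 1 x) = Complex.I • V A 0 x) (A A' B B' : Fin 2) :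
    g x (V A A' x) (V B B' x) = g x (V 0 0 x) (V 1 1 x) * (eps A B * eps A' B') := by
  have hi : Complex.I * Complex.I = -1 := Complex.I_mul_I
  have hgI (v w : TangentSpace 𝓘(ℂ, C4) x) : g x (I x v) (I x w) = g x v w := by
    have := h.hermitian 1 0 0 (by norm_num) x v w
    rwa [combo_I] at this
  have hgK (v w : TangentSpace 𝓘(ℂ, C4) x) : g x (K x v) (K x w) = g x v w := by
    have := h.hermitian 0 0 1 (by norm_num) x v w
    rwa [combo_K] at this
  -- `K` is an isometry acting on both arguments by `i`, so this value equals its own negative.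
  have h11 (A B : Fin 2) : g x (V A 1 x) (V B 1 x) = 0 := by
    have := hgK (V A 1 x) (V B 1 x)
    rw [hK₁, hK₁] at this
    simp only [map_smul, smul_apply, smul_eq_mul] at this
    linear_combination (-1 / 2) * this + (1 / 2) * g x (V A 1 x) (V B 1 x) * hi
  have h00 (A B : Fin 2) : g x (V A 0 x) (V B 0 x) = 0 := by
    have := hgK (V A 0 x) (V B 0 x)
    rw [hK₀, hK₀] at this
    simp only [map_smul, smul_apply, smul_eq_mul, map_neg, neg_apply] at this
    linear_combination (-1 / 2) * this + (1 / 2) * g x (V A 0 x) (V B 0 x) * hi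
  -- `I` exchanges the two primed values with a factor `i`. Its isometry makes the mixed block
  -- antisymmetric in `A, B`, hence a multiple of `eps`.
  have h01 (A B : Fin 2) : g x (V A 0 x) (V B 1 x) = -g x (V B 0 x) (V A 1 x) := by
    have := hgI (V A 0 x) (V B 1 x)
    rw [hI₀, hI₁] at this
    simp only [map_smul, smul_apply, smul_eq_mul] at this
    rw [h.metric.symm x (V A 1 x) (V B 0 x)] at this
    linear_combination -this + g x (V B 0 x) (V A 1 x) * hi
  have h10 (A B : Fin 2) : g x (V A 1 x) (V B 0 x) = g x (V B 0 x) (V A 1 x) :=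
    h.metric.symm x _ _
  have hself (A : Fin 2) : g x (V A 0 x) (V A 1 x) = 0 := by
    linear_combination (1 / 2) * h01 A A
  fin_cases A' <;> fin_cases B'
  · exact (h00 A B).trans (by simp [eps])
  · refine Eq.trans (b := g x (V 0 0 x) (V 1 1 x) * eps A B) ?_ (by simp [eps])
    fin_cases A <;> fin_cases B
    · simpa [eps] using hself 0
    · simp [eps]
    · simpa [eps] using h01 1 0
    · simpa [eps] using hself 1
  · refine (h10 A B).trans (Eq.trans (b := g x (V 0 0 x) (V 1 1 x) * eps B A) ?_ ?_)
    · fin_cases A <;> fin_cases B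
      · simpa [eps] using hself 0
      · simpa [eps] using h01 1 0
      · simp [eps]
      · simpa [eps] using hself 1
    · fin_cases A <;> fin_cases B <;> simp [eps]
  · exact (h11 A B).trans (by simp [eps])

theorem HolBilin.contMDiffOn_apply (hg : HolBilin g) {X Y : VField M} {U : Set M}
    (hX : HolVectorOn X U) (hY : HolVectorOn Y U) :
    ContMDiffOn 𝓘(ℂ, C4) 𝓘(ℂ, ℂ) ω (fun x ↦ g x (X x) (Y x)) U := by
  have h := ContMDiffOn.clm_bundle_apply₂ (E₃ := fun _ : M ↦ ℂ) (F₃ := ℂ)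
    (hg.contMDiffOn (s := U)) hX hY
  intro x hx
  exact (Bundle.contMDiffWithinAt_totalSpace.1 (h x hx)).2

/-- Hyper-Hermitian metrics have, locally and up to a conformal factor, null tetrads that satisfy
the Lax condition. -/
theorem IsHyperHermitian.exists_null_tetrad (h : IsHyperHermitian g I J K) (p : M) :
    ∃ (U : Set M) (V : TetradField M) (Ω : M → ℂ),
      IsOpen U ∧ p ∈ U ∧ IsHolFrameOn V U ∧ LaxOn V U ∧
      ContMDiffOn 𝓘(ℂ, C4) 𝓘(ℂ, ℂ) ω Ω U ∧ (∀ x ∈ U, Ω x ≠ 0) ∧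
      IsNullTetradOn (fun x ↦ Ω x • g x) I J K V U := by
  obtain ⟨U, V, hU, hp, hV, hlax, hIK⟩ := h.hypercomplex.exists_tetrad p
  have hc := h.hypercomplex
  have hi : Complex.I * Complex.I = -1 := Complex.I_mul_I
  have hK₁ {x : M} (hx : x ∈ U) (A : Fin 2) := (hIK x hx A).1
  have hI₁ {x : M} (hx : x ∈ U) (A : Fin 2) := (hIK x hx A).2
  have hI₀ {x : M} (hx : x ∈ U) (A : Fin 2) : I x (V A 0 x) = Complex.I • V A 1 x := by
    have h1 := congrArg (fun v ↦ Complex.I • I x v) (hI₁ hx A)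
    simp only [hc.I_sq, map_smul, smul_smul, hi, neg_one_smul, smul_neg] at h1
    exact (neg_injective h1).symm
  have hJ₁ {x : M} (hx : x ∈ U) (A : Fin 2) : J x (V A 1 x) = V A 0 x := by
    rw [← neg_neg (J x (V A 1 x)), ← hc.I_K, hK₁ hx, map_smul, hI₁ hx, smul_smul, hi,
      neg_one_smul, neg_neg]
  have hJ₀ {x : M} (hx : x ∈ U) (A : Fin 2) : J x (V A 0 x) = -V A 1 x := by
    rw [← hJ₁ hx, hc.J_sq]
  have hK₀ {x : M} (hx : x ∈ U) (A : Fin 2) : K x (V A 0 x) = -(Complex.I • V A 0 x) := by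
    rw [← hc.I_J, hJ₀ hx, map_neg, hI₁ hx]
  have hg {x : M} (hx : x ∈ U) := h.metric_tetrad (hK₀ hx) (hK₁ hx) (hI₀ hx) (hI₁ hx)
  -- If this factor vanished, all products of tetrad vectors would vanish, against nondegeneracy.
  -- Its inverse is the conformal factor.
  have hne (x : M) (hx : x ∈ U) : g x (V 0 0 x) (V 1 1 x) ≠ 0 := by
    intro h0
    refine (hV.indep x hx).ne_zero (0, 0) (h.metric.nondegenerate x _ fun w ↦ ?_)
    obtain ⟨c, rfl⟩ : ∃ c, w = frameMap V x c :=
      ⟨_, (isInvertible_frameMap (hV.indep x hx)).inverse_apply_eq.1 rfl⟩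
    rw [frameMap, combination_apply, map_sum]
    refine Finset.sum_eq_zero fun q _ ↦ ?_
    rw [map_smul, hg hx, h0, zero_mul, smul_zero]
  refine ⟨U, V, fun x ↦ (g x (V 0 0 x) (V 1 1 x))⁻¹, hU, hp, hV, hlax,
    (h.metric.hol.contMDiffOn_apply (hV.hol 0 0) (hV.hol 1 1)).inv₀ hne,
    fun x hx ↦ inv_ne_zero (hne x hx), fun x hx A A' B B' ↦ ?_, fun a b c habc x hx A ↦ ?_⟩
  · exact (congrArg ((g x (V 0 0 x) (V 1 1 x))⁻¹ * ·) (hg hx A A' B B')).trans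
      (inv_mul_cancel_left₀ (hne x hx) _)
  · exact combo_lax_stereo (hI₀ hx) (hI₁ hx) (hJ₀ hx) (hJ₁ hx) (hK₀ hx) (hK₁ hx) habc A

end HyperHermitianTetrad

end HyperHermitian

end

open HyperHermitian in
theorem mainTheorem1 {M : Type*} [TopologicalSpace M] [ChartedSpace C4 M]
    [IsManifold 𝓘(ℂ, C4) ω M] :
    (∀ V : TetradField M, IsHolFrameOn V Set.univ → LaxOn V Set.univ →
      ∃ (g : BilinField M) (I J K : EndField M),
        IsHyperHermitian g I J K ∧ IsNullTetradOn g I J K V Set.univ) ∧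
    (∀ (g : BilinField M) (I J K : EndField M), IsHyperHermitian g I J K →
      ∀ p : M, ∃ (U : Set M) (V : TetradField M) (Ω : M → ℂ),
        IsOpen U ∧ p ∈ U ∧ IsHolFrameOn V U ∧ LaxOn V U ∧
        ContMDiffOn 𝓘(ℂ, C4) 𝓘(ℂ, ℂ) ω Ω U ∧ (∀ x ∈ U, Ω x ≠ 0) ∧
        IsNullTetradOn (fun x ↦ Ω x • g x) I J K V U) ∧
    (∀ (U : Set M) (V : TetradField M), IsOpen U → IsHolFrameOn V U →
      (LaxOn V U ↔ CommutatorEqsOn V U)) := by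
  refine ⟨fun V hV h ↦ exists_isHyperHermitian_isNullTetradOn hV
      ((laxOn_iff_commutatorEqsOn isOpen_univ hV.hol).1 h),
    fun g I J K h p ↦ h.exists_null_tetrad p,
    fun U V hU hV ↦ laxOn_iff_commutatorEqsOn hU hV.hol⟩
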